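/- Let $d\ge 1$, let $V:\mathbb Z^d\to\mathbb R$ be arbitrary, and let $H=\Delta+V$ be the self-adjoint operator $(H\psi)(n)=\sum_{|n-m|=1}\psi(m)+V(n)\psi(n)$ on $\ell^2(\mathbb Z^d)$, with domain $\{\psi\in\ell^2 : H\psi\in\ell^2\}$, where $|n|=\sum_i|n_i|$. Let $\mu_{\delta_0}$ be the spectral measure of $\delta_0$ and $H$, that is, the finite Borel measure on $\mathbb R$ with $\langle (H-z)^{-1}\delta_0,\delta_0\rangle=\int\frac{d\mu_{\delta_0}(x)}{x-z}$ for all non-real $z$. Let $\rho_0,\rho_1,\dots$ be the orthonormal vectors obtained from $\delta_0,H\delta_0,H^2\delta_0,\dots$ by the Gram–Schmidt procedure, and consider the tridiagonal representation of $H$ in them, in which $\rho_n$ is identified with $\delta_{n+1}$: $a(n)=\langle\rho_n,H\rho_{n-1}\rangle$ and $b(n)=\langle\rho_{n-1},H\rho_{n-1}\rangle$ for $n\ge 1$, and $a(0)=1$. For $E,\theta\in\mathbb R$ let $u_\theta(n,E)$, $n\ge0$, be the solution of $a(n)u(n+1)+a(n-1)u(n-1)+b(n)u(n)=Eu(n)$,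 $n\ge 1$, with $u_\theta(0,E)=\sin\theta$, $u_\theta(1,E)=\cos\theta$. For $\ell\ge0$ put $\|u\|_\ell^2=\sum_{n=1}^{\lfloor \ell\rfloor}|u(n)|^2+(\ell-\lfloor \ell\rfloor)|u(\lfloor \ell\rfloor+1)|^2$. For $\epsilon>0$ let $L^+_\epsilon(E)$ be the number $\ell$ with $\max_\theta\|u_\theta(\cdot,E)\|_\ell\cdot\min_\theta\|u_\theta(\cdot,E)\|_\ell=\epsilon^{-1}$ (and $L^+_\epsilon(E)=\infty$ if there is no such $\ell$). For $R>0$ let $\chi_R$ be the orthogonal projection of $\ell^2(\mathbb Z^d)$ on the functions supported in the ball $\{n : |n|<R\}$. For a function $A$ of time write $\langle A\rangle_T=\frac2T\int_0^\infty e^{-2t/T}A(t)\,dt$. Then there is a universal constant $C>0$ (independent of $d$, $V$, $T$, $L$) such that for all $d\ge 1$, all $V$, all $T>0$ and all $L>1$, $$\big\langle\|\chi_{L+1}e^{-iHt}\delta_0\|^2\big\rangle_T> C\,\mu_{\delta_0}\big(\{E : L^+_{T^{-1}}(E)\le L\}\big).$$ -/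

import Mathlib

open MeasureTheory Filter Topology

noncomputable section

namespace Lattice

/-- The Hilbert space `ℓ²(ℤ^d)`. -/
abbrev L2 (d : ℕ) : Type := lp (fun _ : Fin d → ℤ => ℂ) 2

/-- The length `|n| = ∑ |n_i|` of a lattice site. -/
def siteNorm {d : ℕ} (n : Fin d → ℤ) : ℤ := ∑ i, |n i|

/-- The sites `m` with `|n - m| = 1`. -/
def neighbors {d : ℕ} (n : Fin d → ℤ) : Finset (Fin d → ℤ) :=
  {m ∈ Finset.Icc (fun i => n i - 1) (fun i => n i + 1) | siteNorm (n - m) = 1}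

/-- The sites `n` with `|n| < R`. -/
def ball (d : ℕ) (R : ℝ) : Finset (Fin d → ℤ) :=
  {n ∈ Finset.Icc (fun _ => -⌈R⌉) (fun _ => ⌈R⌉) | (siteNorm n : ℝ) < R}

theorem abs_le_siteNorm {d : ℕ} (n : Fin d → ℤ) (i : Fin d) : |n i| ≤ siteNorm n :=
  Finset.single_le_sum (f := fun i => |n i|) (fun _ _ => abs_nonneg _) (Finset.mem_univ i)

theorem mem_neighbors {d : ℕ} {n m : Fin d → ℤ} : m ∈ neighbors n ↔ siteNorm (n - m) = 1 := by
  simp only [neighbors, Finset.mem_filter, Finset.mem_Icc, Pi.le_def, and_iff_right_iff_imp]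
  intro h
  have h1 : ∀ i, |n i - m i| ≤ 1 := fun i => h ▸ abs_le_siteNorm (n - m) i
  exact ⟨fun i => by have := abs_le.1 (h1 i); omega, fun i => by have := abs_le.1 (h1 i); omega⟩

theorem mem_ball {d : ℕ} {R : ℝ} {n : Fin d → ℤ} : n ∈ ball d R ↔ (siteNorm n : ℝ) < R := by
  simp only [ball, Finset.mem_filter, Finset.mem_Icc, Pi.le_def, and_iff_right_iff_imp]
  intro h
  have h1 : siteNorm n ≤ ⌈R⌉ := by exact_mod_cast h.le.trans (Int.le_ceil R)
  have h2 : ∀ i, |n i| ≤ ⌈R⌉ := fun i => (abs_le_siteNorm n i).trans h1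
  exact ⟨fun i => (abs_le.1 (h2 i)).1, fun i => (abs_le.1 (h2 i)).2⟩

theorem mem_neighbors_comm {d : ℕ} {n m : Fin d → ℤ} : m ∈ neighbors n ↔ n ∈ neighbors m := by
  simp only [mem_neighbors, siteNorm, Pi.sub_apply]
  simp_rw [abs_sub_comm]

theorem card_neighbors_le {d : ℕ} (n : Fin d → ℤ) : (neighbors n).card ≤ 3 ^ d := by
  refine (Finset.card_filter_le _ _).trans (le_of_eq ?_)
  rw [Pi.card_Icc]
  have : ∀ i, (Finset.Icc (n i - 1) (n i + 1)).card = 3 := fun i => by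
    rw [Int.card_Icc]; omega
  simp [this]

/-- The expression `((Δ + V)ψ)(n) = ∑_{|n - m| = 1} ψ(m) + V(n) ψ(n)` for an arbitrary function `ψ`
on the lattice. -/
def action {d : ℕ} (V : (Fin d → ℤ) → ℝ) :
    ((Fin d → ℤ) → ℂ) →ₗ[ℂ] ((Fin d → ℤ) → ℂ) where
  toFun ψ n := ∑ m ∈ neighbors n, ψ m + (V n : ℂ) * ψ n
  map_add' φ ψ := by
    funext n
    simp only [Pi.add_apply, Finset.sum_add_distrib]
    ring
  map_smul' c ψ := by
    funext n
    simp only [Pi.smul_apply, smul_eq_mul, ← Finset.mul_sum, RingHom.id_apply]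
    ring

/-- The operator `H = Δ + V` on `ℓ²(ℤ^d)` with its natural domain `{ψ ∈ ℓ² | (Δ + V)ψ ∈ ℓ²}`,
which is the domain of the multiplication by `V`. -/
def hamiltonian {d : ℕ} (V : (Fin d → ℤ) → ℝ) : L2 d →ₗ.[ℂ] L2 d where
  domain :=
    { carrier := {ψ | Memℓp (action V ψ) 2}
      add_mem' := fun {φ ψ} hφ hψ => by
        simp only [Set.mem_ofPred_eq, lp.coeFn_add, map_add] at *
        exact hφ.add hψ
      zero_mem' := by
        simp only [Set.mem_ofPred_eq, lp.coeFn_zero, map_zero]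
        exact zero_memℓp
      smul_mem' := fun c ψ hψ => by
        simp only [Set.mem_ofPred_eq, lp.coeFn_smul, map_smul] at *
        exact hψ.const_smul c }
  toFun :=
    { toFun := fun ψ => ⟨action V ψ.1, ψ.2⟩
      map_add' := fun φ ψ => lp.ext (map_add (action V) (φ.1 : (Fin d → ℤ) → ℂ) ψ.1)
      map_smul' := fun c ψ => lp.ext (map_smul (action V) c (ψ.1 : (Fin d → ℤ) → ℂ)) }

theorem hamiltonian_apply {d : ℕ} (V : (Fin d → ℤ) → ℝ) (ψ : (hamiltonian V).domain) :
    ((hamiltonian V ψ : L2 d) : (Fin d → ℤ) → ℂ) = action V (ψ : L2 d) := rfl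

theorem memlp_of_finite {d : ℕ} {f : (Fin d → ℤ) → ℂ} (hf : f.support.Finite) : Memℓp f 2 :=
  (memℓp_zero_iff.2 hf).of_exponent_ge zero_le

theorem action_support_finite {d : ℕ} (V : (Fin d → ℤ) → ℝ) {f : (Fin d → ℤ) → ℂ}
    (hf : f.support.Finite) : (action V f).support.Finite := by
  classical
  refine ((hf.toFinset.biUnion neighbors ∪ hf.toFinset).finite_toSet).subset fun n hn => ?_
  by_contra h
  simp only [Finset.coe_union, Finset.coe_biUnion, Set.mem_union, Set.mem_iUnion, Finset.mem_coe,
    Set.Finite.mem_toFinset, Function.mem_support, not_or, not_exists, not_not] at h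
  refine hn ?_
  change ∑ m ∈ neighbors n, f m + (V n : ℂ) * f n = 0
  rw [h.2, mul_zero, add_zero]
  refine Finset.sum_eq_zero fun m hm => ?_
  by_contra hm'
  exact h.1 m hm' (mem_neighbors_comm.1 hm)

theorem mem_domain_of_finite {d : ℕ} (V : (Fin d → ℤ) → ℝ) {f : L2 d}
    (hf : (f : (Fin d → ℤ) → ℂ).support.Finite) : f ∈ (hamiltonian V).domain :=
  memlp_of_finite (action_support_finite V hf)

/-- The vector `δ_n`, as an element of the domain of `H`. -/
def delta {d : ℕ} (V : (Fin d → ℤ) → ℝ) (n : Fin d → ℤ) : (hamiltonian V).domain :=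
  ⟨lp.single 2 n 1, mem_domain_of_finite V
    ((Set.finite_singleton n).subset fun m hm => by
      by_contra h
      exact hm (lp.single_apply_ne (E := fun _ : Fin d → ℤ => ℂ) 2 n 1 h))⟩

theorem finite_spectral {W : Type*} [NormedAddCommGroup W] [InnerProductSpace ℂ W]
    [FiniteDimensional ℂ W] (T : W →ₗ[ℂ] W) (hT : T.IsSymmetric) (ψ : W) :
    ∃ μ : FiniteMeasure ℝ, (μ.mass : ℝ) ≤ ‖ψ‖ ^ 2 ∧
      (∀ r : ℝ, 0 < r → (μ (Metric.closedBall 0 r)ᶜ : ℝ) ≤ ‖T ψ‖ ^ 2 / r ^ 2) ∧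
      ∀ z : ℂ, z.im ≠ 0 → ∀ g : W,
        ‖inner ℂ ψ g - ∫ x, ((x : ℂ) - z)⁻¹ ∂(μ : Measure ℝ)‖
          ≤ ‖ψ‖ * (‖T g - z • g - ψ‖ / |z.im|) := by
  classical
  let b := hT.eigenvectorBasis rfl
  let l := hT.eigenvalues rfl
  have hb : ∀ (v : W) i, b.repr (T v) i = (l i : ℂ) * b.repr v i :=
    fun v i => hT.eigenvectorBasis_apply_self_apply rfl v i
  have hn : ∀ v : W, ∑ i, ‖b.repr v i‖ ^ 2 = ‖v‖ ^ 2 := fun v => by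
    rw [← b.repr.norm_map v, EuclideanSpace.norm_sq_eq]
  let c : Fin (Module.finrank ℂ W) → NNReal := fun i => ‖b.repr ψ i‖₊ ^ 2
  have hc : ∀ i, (c i : ℝ) = ‖b.repr ψ i‖ ^ 2 := fun i => by simp [c]
  let ν : Measure ℝ := ∑ i, c i • Measure.dirac (l i)
  have : IsFiniteMeasure ν := by infer_instance
  have hset : ∀ s : Set ℝ, MeasurableSet s →
      (ν s).toReal = ∑ i, ‖b.repr ψ i‖ ^ 2 * s.indicator 1 (l i) := fun s hs => by
    simp only [ν, Measure.coe_finsetSum, Finset.sum_apply, Measure.smul_apply]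
    rw [ENNReal.toReal_sum]
    · refine Finset.sum_congr rfl fun i _ => ?_
      rw [Measure.dirac_apply' _ hs, ← hc i]
      by_cases h : l i ∈ s <;> simp [h, ENNReal.smul_def]
    · intro i _
      exact (measure_lt_top (c i • Measure.dirac (l i)) s).ne
  refine ⟨⟨ν, this⟩, ?_, ?_, ?_⟩
  · change (ν Set.univ).toReal ≤ _
    rw [hset _ MeasurableSet.univ, ← hn ψ]
    simp
  · intro r hr
    change (ν _).toReal ≤ _
    rw [hset _ Metric.isClosed_closedBall.measurableSet.compl, ← hn, Finset.sum_div]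
    refine Finset.sum_le_sum fun i _ => ?_
    rw [hb, le_div_iff₀ (by positivity), norm_mul, mul_pow]
    by_cases h : l i ∈ (Metric.closedBall (0 : ℝ) r)ᶜ
    · have h1 : r < |l i| := by simpa using h
      have h2 : r ^ 2 ≤ |l i| ^ 2 := by gcongr
      simp only [h, Set.indicator_of_mem, Pi.one_apply, mul_one]
      rw [mul_comm]
      simp only [Complex.norm_real, Real.norm_eq_abs]
      gcongr
    · simp only [h, not_false_eq_true, Set.indicator_of_notMem, mul_zero, zero_mul]
      positivity
  · intro z hz g
    have hne : ∀ i, (l i : ℂ) - z ≠ 0 := fun i h => hz (by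
      have := congrArg Complex.im h
      simpa using this)
    have hle : ∀ i, |z.im| ≤ ‖(l i : ℂ) - z‖ := fun i => by
      have := Complex.abs_im_le_norm ((l i : ℂ) - z)
      simpa using this
    have hpos : 0 < |z.im| := abs_pos.2 hz
    have hint : ∫ x, ((x : ℂ) - z)⁻¹ ∂ν
        = ∑ i, (starRingEnd ℂ) (b.repr ψ i) * (b.repr ψ i * ((l i : ℂ) - z)⁻¹) := by
      rw [integral_finsetSum_measure]
      · refine Finset.sum_congr rfl fun i _ => ?_
        rw [integral_smul_nnreal_measure, integral_dirac, ← mul_assoc, Complex.conj_mul']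
        rw [NNReal.smul_def, hc, Complex.real_smul]
        push_cast
        rfl
      · intro i _
        exact (integrable_dirac (by simp)).smul_measure_nnreal
    let e := T g - z • g - ψ
    have he : ∀ i, b.repr g i - b.repr ψ i * ((l i : ℂ) - z)⁻¹
        = b.repr e i * ((l i : ℂ) - z)⁻¹ := fun i => by
      have : b.repr e i = (l i : ℂ) * b.repr g i - z * b.repr g i - b.repr ψ i := by
        simp [e, hb]
      rw [this]
      field_simp [hne i]
    change ‖inner ℂ ψ g - ∫ x, ((x : ℂ) - z)⁻¹ ∂ν‖ ≤ _
    let w : EuclideanSpace ℂ (Fin (Module.finrank ℂ W)) :=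
      WithLp.toLp 2 fun i => b.repr e i * ((l i : ℂ) - z)⁻¹
    have hw : inner ℂ ψ g - ∫ x, ((x : ℂ) - z)⁻¹ ∂ν = inner ℂ (b.repr ψ) w := by
      rw [hint, ← b.repr.inner_map_map ψ g, PiLp.inner_apply, PiLp.inner_apply,
        ← Finset.sum_sub_distrib]
      refine Finset.sum_congr rfl fun i _ => ?_
      simp only [RCLike.inner_apply, w]
      rw [← he i]
      ring
    rw [hw]
    refine (norm_inner_le_norm _ _).trans ?_
    rw [b.repr.norm_map]
    gcongr
    rw [← sq_le_sq₀ (norm_nonneg _) (by positivity), EuclideanSpace.norm_sq_eq, div_pow, ← hn,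
      Finset.sum_div]
    refine Finset.sum_le_sum fun i _ => ?_
    simp only [w, norm_mul, norm_inv, mul_pow, inv_pow]
    rw [div_eq_mul_inv]
    have := hle i
    gcongr

/-- `μ` is the spectral measure of the vector `ψ` and the self-adjoint operator `H`: a finite Borel
measure on `ℝ` with `⟨(H - z)⁻¹ψ, ψ⟩ = ∫ dμ(x) / (x - z)` for all non-real `z`. -/
def IsSpectralMeasure {E : Type*} [NormedAddCommGroup E] [InnerProductSpace ℂ E]
    (H : E →ₗ.[ℂ] E) (ψ : E) (μ : Measure ℝ) : Prop :=
  IsFiniteMeasure μ ∧ ∀ z : ℂ, z.im ≠ 0 → ∀ g : H.domain, H g - z • (g : E) = ψ →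
    inner ℂ ψ (g : E) = ∫ x : ℝ, ((x : ℂ) - z)⁻¹ ∂μ

/-- The restriction of a function on the lattice to a finite set of sites. -/
def restr {d : ℕ} (F : Finset (Fin d → ℤ)) (ψ : (Fin d → ℤ) → ℂ) : EuclideanSpace ℂ F :=
  WithLp.toLp 2 fun n => ψ n

/-- The matrix of `Δ + V` on a finite set of sites. -/
def boxMatrix {d : ℕ} (V : (Fin d → ℤ) → ℝ) (F : Finset (Fin d → ℤ)) : Matrix F F ℂ :=
  fun n m => (if m.1 ∈ neighbors n.1 then 1 else 0) + if m = n then (V n : ℂ) else 0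

theorem boxMatrix_isHermitian {d : ℕ} (V : (Fin d → ℤ) → ℝ) (F : Finset (Fin d → ℤ)) :
    (boxMatrix V F).IsHermitian := by
  ext n m
  simp only [Matrix.conjTranspose_apply, boxMatrix, star_add, apply_ite (star : ℂ → ℂ), star_one,
    star_zero]
  congr 1
  · simp only [mem_neighbors_comm]
  · by_cases h : n = m
    · subst h; simp
    · simp [h, Ne.symm h]

theorem norm_restr_sq {d : ℕ} (F : Finset (Fin d → ℤ)) (ψ : (Fin d → ℤ) → ℂ) :
    ‖restr F ψ‖ ^ 2 = ∑ n ∈ F, ‖ψ n‖ ^ 2 := by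
  rw [EuclideanSpace.norm_sq_eq, ← Finset.sum_coe_sort F fun n => ‖ψ n‖ ^ 2]
  rfl

theorem hasSum_norm_sq {d : ℕ} (ψ : L2 d) : HasSum (fun n => ‖ψ n‖ ^ 2) (‖ψ‖ ^ 2) := by
  have h := lp.hasSum_norm (p := 2) (by norm_num) ψ
  simpa using h

theorem norm_restr_le {d : ℕ} (F : Finset (Fin d → ℤ)) (ψ : L2 d) : ‖restr F ψ‖ ≤ ‖ψ‖ := by
  rw [← sq_le_sq₀ (norm_nonneg _) (norm_nonneg _), norm_restr_sq]
  exact sum_le_hasSum _ (fun _ _ => by positivity) (hasSum_norm_sq ψ)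

theorem tendsto_inner_restr {d : ℕ} (φ ψ : L2 d) :
    Tendsto (fun F => inner ℂ (restr F φ) (restr F ψ)) atTop (𝓝 (inner ℂ φ ψ)) := by
  have h : HasSum _ _ := lp.hasSum_inner (𝕜 := ℂ) φ ψ
  refine Tendsto.congr (fun F => ?_) h
  rw [PiLp.inner_apply, ← Finset.sum_coe_sort F]
  rfl

theorem boxMatrix_error {d : ℕ} (V : (Fin d → ℤ) → ℝ) (F : Finset (Fin d → ℤ)) (g : L2 d) :
    ‖Matrix.toEuclideanLin (boxMatrix V F) (restr F g) - restr F (action V g)‖ ^ 2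
      ≤ (3 ^ d) ^ 2 * (‖g‖ ^ 2 - ‖restr F g‖ ^ 2) := by
  classical
  have hdiff : Matrix.toEuclideanLin (boxMatrix V F) (restr F g) - restr F (action V g)
      = restr F fun n => -∑ m ∈ neighbors n \ F, g m := by
    ext n
    have h1 : (Matrix.toEuclideanLin (boxMatrix V F) (restr F g)) n
        = ∑ m ∈ neighbors n.1 ∩ F, g m + (V n : ℂ) * g n := by
      have : (Matrix.toEuclideanLin (boxMatrix V F) (restr F g)) n
        = ∑ m : F, boxMatrix V F n m * g m := rfl
      rw [this]
      simp only [boxMatrix, add_mul, Finset.sum_add_distrib, ite_mul, one_mul, zero_mul]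
      congr 1
      · rw [Finset.sum_coe_sort F fun m => if m ∈ neighbors n.1 then g m else 0,
          ← Finset.sum_filter, Finset.filter_mem_eq_inter, Finset.inter_comm]
      · simp
    have h2 : restr F (action V g) n = ∑ m ∈ neighbors n.1, g m + (V n : ℂ) * g n := rfl
    rw [PiLp.sub_apply, h1, h2, ← Finset.sum_inter_add_sum_sdiff (neighbors n.1) F]
    simp only [restr]
    ring
  rw [hdiff, norm_restr_sq]
  have hcs : ∀ n, ‖-∑ m ∈ neighbors n \ F, g m‖ ^ 2 ≤ 3 ^ d * ∑ m ∈ neighbors n \ F, ‖g m‖ ^ 2 := by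
    intro n
    rw [norm_neg]
    calc ‖∑ m ∈ neighbors n \ F, g m‖ ^ 2 ≤ (∑ m ∈ neighbors n \ F, ‖g m‖) ^ 2 := by
          gcongr; exact norm_sum_le _ _
      _ ≤ (neighbors n \ F).card * ∑ m ∈ neighbors n \ F, ‖g m‖ ^ 2 := sq_sum_le_card_mul_sum_sq
      _ ≤ 3 ^ d * ∑ m ∈ neighbors n \ F, ‖g m‖ ^ 2 := by
          gcongr
          exact_mod_cast (Finset.card_le_card Finset.sdiff_subset).trans (card_neighbors_le n)
  let G := F.biUnion neighbors
  have hswap : ∑ n ∈ F, ∑ m ∈ neighbors n \ F, ‖g m‖ ^ 2 ≤ 3 ^ d * ∑ m ∈ G \ F, ‖g m‖ ^ 2 := by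
    have : ∑ n ∈ F, ∑ m ∈ neighbors n \ F, ‖g m‖ ^ 2
        = ∑ m ∈ G \ F, ∑ n ∈ F with m ∈ neighbors n, ‖g m‖ ^ 2 := by
      refine Finset.sum_comm' fun n m => ?_
      simp only [Finset.mem_sdiff, Finset.mem_filter, G, Finset.mem_biUnion]
      constructor
      · rintro ⟨h1, h2, h3⟩
        exact ⟨⟨h1, h2⟩, ⟨n, h1, h2⟩, h3⟩
      · rintro ⟨⟨h1, h2⟩, _, h3⟩
        exact ⟨h1, h2, h3⟩
    rw [this, Finset.mul_sum]
    refine Finset.sum_le_sum fun m _ => ?_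
    rw [Finset.sum_const, nsmul_eq_mul]
    gcongr
    have : {n ∈ F | m ∈ neighbors n} ⊆ neighbors m := fun n hn =>
      mem_neighbors_comm.1 (Finset.mem_filter.1 hn).2
    exact_mod_cast (Finset.card_le_card this).trans (card_neighbors_le m)
  have htail : ∑ m ∈ G \ F, ‖g m‖ ^ 2 ≤ ‖g‖ ^ 2 - ‖restr F g‖ ^ 2 := by
    rw [norm_restr_sq, le_sub_iff_add_le, ← Finset.sum_union Finset.sdiff_disjoint]
    exact sum_le_hasSum _ (fun _ _ => by positivity) (hasSum_norm_sq g)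
  calc ∑ n ∈ F, ‖-∑ m ∈ neighbors n \ F, g m‖ ^ 2
      ≤ ∑ n ∈ F, 3 ^ d * ∑ m ∈ neighbors n \ F, ‖g m‖ ^ 2 := Finset.sum_le_sum fun n _ => hcs n
    _ = 3 ^ d * ∑ n ∈ F, ∑ m ∈ neighbors n \ F, ‖g m‖ ^ 2 := by rw [Finset.mul_sum]
    _ ≤ 3 ^ d * (3 ^ d * (‖g‖ ^ 2 - ‖restr F g‖ ^ 2)) := by
        gcongr
        exact hswap.trans (by gcongr)
    _ = _ := by ring

/-- Every vector in the domain of `H = Δ + V` has a spectral measure. It is a weak limit of spectral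
measures of the restrictions of `H` to finite sets of sites. -/
theorem exists_isSpectralMeasure {d : ℕ} (V : (Fin d → ℤ) → ℝ) (ψ : (hamiltonian V).domain) :
    ∃ μ : Measure ℝ, IsSpectralMeasure (hamiltonian V) (ψ : L2 d) μ := by
  let T := fun F : Finset (Fin d → ℤ) => Matrix.toEuclideanLin (boxMatrix V F)
  have hT : ∀ F, (T F).IsSymmetric := fun F =>
    Matrix.isSymmetric_toEuclideanLin_iff.2 (boxMatrix_isHermitian V F)
  choose μ hμ1 hμ2 hμ3 using fun F => finite_spectral (T F) (hT F) (restr F (ψ : L2 d))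
  set B : ℝ := ‖hamiltonian V ψ‖ + 3 ^ d * ‖(ψ : L2 d)‖
  have hB : ∀ F, ‖T F (restr F (ψ : L2 d))‖ ≤ B := fun F => by
    have h1 : ‖T F (restr F (ψ : L2 d)) - restr F (action V (ψ : L2 d))‖ ≤ 3 ^ d * ‖(ψ : L2 d)‖ := by
      rw [← sq_le_sq₀ (norm_nonneg _) (by positivity), mul_pow]
      refine (boxMatrix_error V F ψ).trans ?_
      gcongr
      linarith [sq_nonneg ‖restr F (ψ : L2 d)‖]
    have h2 : ‖restr F (action V (ψ : L2 d))‖ ≤ ‖hamiltonian V ψ‖ := norm_restr_le F (hamiltonian V ψ)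
    have h3 := norm_le_insert' (T F (restr F (ψ : L2 d))) (restr F (action V (ψ : L2 d)))
    linarith
  let u : ℕ → NNReal := fun n => (B ^ 2 / ((n : ℝ) + 1) ^ 2).toNNReal
  have hu : Tendsto u atTop (𝓝 0) := by
    have : Tendsto (fun n : ℕ => B ^ 2 / ((n : ℝ) + 1) ^ 2) atTop (𝓝 0) := by
      have h1 : Tendsto (fun n : ℕ => ((n : ℝ) + 1) ^ 2) atTop atTop :=
        (tendsto_pow_atTop (by norm_num)).comp
          (tendsto_atTop_add_const_right _ _ tendsto_natCast_atTop_atTop)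
      exact h1.const_div_atTop _
    have h2 := (continuous_real_toNNReal.tendsto 0).comp this
    rwa [Real.toNNReal_zero] at h2
  have hK := isCompact_setOfPred_finiteMeasure_mass_le_compl_isCompact_le
    (K := fun n : ℕ => Metric.closedBall (0 : ℝ) ((n : ℝ) + 1)) (‖(ψ : L2 d)‖₊ ^ 2) hu
    (fun n => isCompact_closedBall _ _) (Or.inl inferInstance)
  let 𝒰 : Ultrafilter (Finset (Fin d → ℤ)) := Ultrafilter.of atTop
  have h𝒰 : (𝒰 : Filter (Finset (Fin d → ℤ))) ≤ atTop := Ultrafilter.of_le _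
  obtain ⟨ν, -, hν⟩ := hK.ultrafilter_le_nhds (𝒰.map μ) (by
    rw [Ultrafilter.coe_map, le_principal_iff, Filter.mem_map]
    refine Filter.univ_mem' fun F => ?_
    refine ⟨?_, fun n => ?_⟩
    · rw [← NNReal.coe_le_coe]
      refine (hμ1 F).trans ?_
      push_cast
      gcongr
      exact norm_restr_le F ψ
    · rw [← NNReal.coe_le_coe]
      refine (hμ2 F _ (by positivity)).trans ?_
      simp only [u]
      rw [Real.coe_toNNReal _ (by positivity)]
      gcongr
      exact hB F)
  have hν' : Tendsto μ 𝒰 (𝓝 ν) := hν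
  refine ⟨ν, inferInstance, fun z hz g hg => ?_⟩
  have hne : ∀ x : ℝ, (x : ℂ) - z ≠ 0 := fun x h => hz (by simpa using congrArg Complex.im h)
  let f : BoundedContinuousFunction ℝ ℂ := BoundedContinuousFunction.ofNormedAddCommGroup
    (fun x : ℝ => ((x : ℂ) - z)⁻¹)
    (by fun_prop (disch := exact hne _)) |z.im|⁻¹ (fun x => by
      rw [norm_inv]
      gcongr
      simpa using Complex.abs_im_le_norm ((x : ℂ) - z))
  have hlim1 : Tendsto (fun F => ∫ x, ((x : ℂ) - z)⁻¹ ∂(μ F : Measure ℝ)) 𝒰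
      (𝓝 (∫ x, ((x : ℂ) - z)⁻¹ ∂(ν : Measure ℝ))) :=
    (FiniteMeasure.tendsto_iff_forall_integral_rclike_tendsto ℂ).1 hν' f
  have hlim2 := (tendsto_inner_restr (ψ : L2 d) (g : L2 d)).mono_left h𝒰
  have herr : ∀ F, ‖T F (restr F (g : L2 d)) - z • restr F (g : L2 d) - restr F (ψ : L2 d)‖
      ≤ √((3 ^ d) ^ 2 * (‖(g : L2 d)‖ ^ 2 - ‖restr F (g : L2 d)‖ ^ 2)) := fun F => by
    refine Real.le_sqrt_of_sq_le ((le_of_eq ?_).trans (boxMatrix_error V F g))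
    congr 2
    have : restr F (action V (g : L2 d)) = z • restr F (g : L2 d) + restr F (ψ : L2 d) := by
      ext n
      have h := congrArg (fun φ : L2 d => φ n) hg
      have h' : action V (g : L2 d) n - z * (g : L2 d) n = (ψ : L2 d) n := h
      change action V (g : L2 d) n = z * (g : L2 d) n + (ψ : L2 d) n
      rw [← h']
      ring
    rw [this]
    abel
  have hlim3 : Tendsto (fun F => inner ℂ (restr F (ψ : L2 d)) (restr F (g : L2 d))
      - ∫ x, ((x : ℂ) - z)⁻¹ ∂(μ F : Measure ℝ)) 𝒰 (𝓝 0) := by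
    refine Tendsto.mono_left ?_ h𝒰
    have hnorm : Tendsto (fun F => ‖restr F (g : L2 d)‖ ^ 2) atTop (𝓝 (‖(g : L2 d)‖ ^ 2)) := by
      have h : HasSum _ _ := hasSum_norm_sq (g : L2 d)
      exact Tendsto.congr (fun F => (norm_restr_sq F _).symm) h
    have hb : Tendsto (fun F => ‖(ψ : L2 d)‖
        * (√((3 ^ d) ^ 2 * (‖(g : L2 d)‖ ^ 2 - ‖restr F (g : L2 d)‖ ^ 2)) / |z.im|))
        atTop (𝓝 0) := by
      have := ((((hnorm.const_sub (‖(g : L2 d)‖ ^ 2)).const_mul ((3 ^ d : ℝ) ^ 2)).sqrt).div_const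
        |z.im|).const_mul ‖(ψ : L2 d)‖
      simpa using this
    refine squeeze_zero_norm (fun F => (hμ3 F z hz (restr F (g : L2 d))).trans ?_) hb
    have := herr F
    have := norm_restr_le F (ψ : L2 d)
    gcongr
  have := tendsto_nhds_unique hlim3 (hlim2.sub hlim1)
  exact (sub_eq_zero.1 this.symm)

/-- The spectral measure `μ_ψ` of a vector `ψ` in the domain of `H = Δ + V`. -/
def spectralMeasure {d : ℕ} (V : (Fin d → ℤ) → ℝ) (ψ : (hamiltonian V).domain) : Measure ℝ :=
  (exists_isSpectralMeasure V ψ).choose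

theorem spectralMeasure_spec {d : ℕ} (V : (Fin d → ℤ) → ℝ) (ψ : (hamiltonian V).domain) :
    IsSpectralMeasure (hamiltonian V) (ψ : L2 d) (spectralMeasure V ψ) :=
  (exists_isSpectralMeasure V ψ).choose_spec

/-- The matrix element `⟨φ, f(H)ψ⟩` of the functional calculus of `H = Δ + V`, for a bounded
measurable `f`. It is obtained by polarization from `⟨ψ, f(H)ψ⟩ = ∫ f dμ_ψ`. -/
def matrixElement {d : ℕ} (V : (Fin d → ℤ) → ℝ) (f : ℝ → ℂ) (φ ψ : (hamiltonian V).domain) : ℂ :=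
  (1 / 4) * ∑ k ∈ Finset.range 4,
    (-Complex.I) ^ k * ∫ x, f x ∂spectralMeasure V (φ + Complex.I ^ k • ψ)

/-- The wavepacket `e^{-iHt}δ_0`, through its coordinates `⟨δ_n, e^{-iHt}δ_0⟩`. -/
def wavepacket {d : ℕ} (V : (Fin d → ℤ) → ℝ) (t : ℝ) (n : Fin d → ℤ) : ℂ :=
  matrixElement V (fun x => Complex.exp (-Complex.I * x * t)) (delta V n) (delta V 0)

/-- `‖χ_R ψ‖²`, with `χ_R` the projection on the sites `n` with `|n| < R`. -/
def ballWeight {d : ℕ} (R : ℝ) (ψ : (Fin d → ℤ) → ℂ) : ℝ := ∑ n ∈ ball d R, ‖ψ n‖ ^ 2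

/-- The time average `(2/T) ∫₀^∞ e^{-2t/T} A(t) dt`. -/
def timeAverage (T : ℝ) (A : ℝ → ℝ) : ℝ :=
  2 / T * ∫ t in Set.Ioi (0 : ℝ), Real.exp (-2 * t / T) * A t

/-! ### The length scale of a Jacobi matrix -/

/-- The solution `u_θ` of `a(n)u(n+1) + a(n-1)u(n-1) + b(n)u(n) = E u(n)`, `n ≥ 1`, with
`u(0) = sin θ`, `u(1) = cos θ`. -/
def jacobiSolution (a b : ℕ → ℝ) (E θ : ℝ) : ℕ → ℝ
  | 0 => Real.sin θ
  | 1 => Real.cos θ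
  | n + 2 => ((E - b (n + 1)) * jacobiSolution a b E θ (n + 1)
      - a n * jacobiSolution a b E θ n) / a (n + 1)

/-- The norm `‖u‖_ℓ`, where `‖u‖_ℓ² = ∑_{n=1}^{⌊ℓ⌋} |u(n)|² + (ℓ - ⌊ℓ⌋)|u(⌊ℓ⌋ + 1)|²`. -/
def truncNorm (ℓ : ℝ) (u : ℕ → ℝ) : ℝ :=
  √(∑ n ∈ Finset.Icc 1 ⌊ℓ⌋₊, |u n| ^ 2 + (ℓ - ⌊ℓ⌋₊) * |u (⌊ℓ⌋₊ + 1)| ^ 2)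

/-- The scale `L⁺_ε(E)`: the number `ℓ ≥ 0` with `max_θ ‖u_θ‖_ℓ · min_θ ‖u_θ‖_ℓ = 1/ε`. If
`a` does not vanish, there is at most one such `ℓ`; the scale is `∞` if there is none. -/
def lengthScale (a b : ℕ → ℝ) (ε E : ℝ) : ENNReal :=
  sInf {x | ∃ ℓ : ℝ, 0 ≤ ℓ ∧ x = ENNReal.ofReal ℓ ∧
    (⨆ θ : ℝ, truncNorm ℓ (jacobiSolution a b E θ)) *
      (⨅ θ : ℝ, truncNorm ℓ (jacobiSolution a b E θ)) = ε⁻¹}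

/-! ### The orthonormal polynomial representation -/

theorem iterate_support_finite {d : ℕ} (V : (Fin d → ℤ) → ℝ) (k : ℕ) :
    ((action V)^[k] (Pi.single 0 1)).support.Finite := by
  induction k with
  | zero =>
    refine (Set.finite_singleton (0 : Fin d → ℤ)).subset fun m hm => ?_
    by_contra h
    exact hm (Pi.single_eq_of_ne h 1)
  | succ k ih =>
    rw [Function.iterate_succ_apply']
    exact action_support_finite V ih

/-- The moment vector `H^k δ_0`. -/
def moment {d : ℕ} (V : (Fin d → ℤ) → ℝ) (k : ℕ) : L2 d :=
  ⟨(action V)^[k] (Pi.single 0 1), memlp_of_finite (iterate_support_finite V k)⟩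

/-- The orthonormal vectors `ρ_0, ρ_1, …` obtained from `δ_0, Hδ_0, H²δ_0, …` by the Gram-Schmidt
procedure. -/
def rho {d : ℕ} (V : (Fin d → ℤ) → ℝ) (k : ℕ) : L2 d :=
  InnerProductSpace.gramSchmidtNormed ℂ (moment V) k

theorem rho_mem_domain {d : ℕ} (V : (Fin d → ℤ) → ℝ) (k : ℕ) : rho V k ∈ (hamiltonian V).domain := by
  refine Submodule.smul_mem _ _ ?_
  refine Submodule.span_le.2 ?_
    (InnerProductSpace.gramSchmidt_mem_span ℂ (moment V) (le_refl k))
  rintro _ ⟨j, -, rfl⟩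
  exact mem_domain_of_finite V (iterate_support_finite V j)

/-- The matrix element `⟨ρ_j, Hρ_k⟩`; it is real. -/
def rhoEntry {d : ℕ} (V : (Fin d → ℤ) → ℝ) (j k : ℕ) : ℝ :=
  (inner ℂ (rho V j) (hamiltonian V ⟨rho V k, rho_mem_domain V k⟩)).re

/-- The off-diagonal entries of the orthonormal polynomial representation, in which `ρ_n` is
identified with `δ_{n+1}`: `a(n) = ⟨ρ_n, Hρ_{n-1}⟩` for `n ≥ 1`, and `a(0) = 1`. -/
def polyA {d : ℕ} (V : (Fin d → ℤ) → ℝ) : ℕ → ℝ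
  | 0 => 1
  | n + 1 => rhoEntry V (n + 1) n

/-- The diagonal entries `b(n) = ⟨ρ_{n-1}, Hρ_{n-1}⟩`, `n ≥ 1`; the value `b(0)` is not used. -/
def polyB {d : ℕ} (V : (Fin d → ℤ) → ℝ) : ℕ → ℝ
  | 0 => 0
  | n + 1 => rhoEntry V n n

end Lattice
end

/-!
The Laplace transform of the wavepacket is the Green function `G_z(n) = ⟨δ_n, (H - z)⁻¹ δ_0⟩`, so
by Plancherel's identity the time-averaged weight in a ball is `ε / π` times the integral of
`∑_{|n| < R} |G_{E + iε}(n)|²` over the energy `E`, with `ε = T⁻¹`.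

The coefficients of `(H - z)⁻¹ δ_0` in the Gram–Schmidt vectors `ρ_n` solve the Jacobi recurrence
with spectral parameter `z` and initial values `-1` and `m(z) = ∫ (x - z)⁻¹ dμ(x)`. When `Re z` is
within `ε = Im z` of `E`, variation of parameters keeps them close to `m(z) u_0 - u_{π/2}` up to a
length `ℓ` at which `max_θ ‖u_θ‖_ℓ · min_θ ‖u_θ‖_ℓ = ε⁻¹`. This product is the root of the Gram
determinant of `u_0` and `u_{π/2}`, so the weight of the coefficients up to `ℓ` is at least a
multiple of `ε⁻¹ Im m(z)`. Since `ρ_n` lives on the sites with `|m| ≤ n`, Bessel's inequality bounds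
that weight by `∑_{|n| < L + 1} |G_z(n)|²` when `ℓ ≤ L`.

Finally `Im m(E + iε)` is a Poisson integral of `μ`, and its integral over the `ε`-neighbourhood of
a set `S` dominates `μ S`.
-/

noncomputable section

namespace DiscreteSchrodinger

open Lattice

/-! ### Plancherel's identity for damped functions on the half-line -/

section Fourier

open scoped FourierTransform

theorem integral_schwartz_mul_fourier {f : ℝ → ℂ} (hf : Integrable f) (φ : SchwartzMap ℝ ℂ) :
    ∫ x, (𝓕 φ) x • f x = ∫ x, φ x • 𝓕 f x := by
  have h := VectorFourier.integral_fourierIntegral_smul_eq_flip (μ := volume) (ν := volume)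
    (L := innerₗ ℝ) Real.continuous_fourierChar (by fun_prop) φ.integrable hf
  rwa [flip_innerₗ] at h

theorem ae_eq_of_forall_integral_schwartz_smul_eq {f g : ℝ → ℂ} (hf : LocallyIntegrable f)
    (hg : LocallyIntegrable g)
    (h : ∀ φ : SchwartzMap ℝ ℂ, ∫ x, φ x • f x = ∫ x, φ x • g x) : f =ᵐ[volume] g := by
  refine ae_eq_of_integral_contDiff_smul_eq hf hg fun p hp hsupp => ?_
  have hp' : ContDiff ℝ (⊤ : ℕ∞) fun x => (p x : ℂ) := Complex.ofRealCLM.contDiff.comp hp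
  have hsupp' : HasCompactSupport fun x => (p x : ℂ) :=
    hsupp.comp_left (g := fun r : ℝ => (r : ℂ)) Complex.ofReal_zero
  have hsmul : ∀ x (w : ℂ), hsupp'.toSchwartzMap hp' x • w = p x • w :=
    fun x w => Complex.coe_smul _ _
  simpa only [hsmul] using h (hsupp'.toSchwartzMap hp')

theorem fourier_toLp_ae_eq {f : ℝ → ℂ} (hf₁ : Integrable f) (hf₂ : MemLp f 2) :
    (𝓕 (hf₂.toLp f) : Lp ℂ 2 (volume : Measure ℝ)) =ᵐ[volume] 𝓕 f := by
  have hcont : Continuous (𝓕 f) :=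
    VectorFourier.fourierIntegral_continuous Real.continuous_fourierChar (by fun_prop) hf₁
  refine ae_eq_of_forall_integral_schwartz_smul_eq
    ((Lp.memLp _).locallyIntegrable (by norm_num)) hcont.locallyIntegrable fun φ => ?_
  have hdistr := congrArg (fun ψ => ψ φ) (Lp.fourier_toTemperedDistribution_eq (hf₂.toLp f))
  simp only [TemperedDistribution.fourier_apply, Lp.toTemperedDistribution_apply] at hdistr
  rw [← hdistr, ← integral_schwartz_mul_fourier hf₁]
  exact integral_congr_ae (by filter_upwards [hf₂.coeFn_toLp] with x hx; rw [hx])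

theorem memLp_fourier {f : ℝ → ℂ} (hf₁ : Integrable f) (hf₂ : MemLp f 2) : MemLp (𝓕 f) 2 :=
  (memLp_congr_ae (fourier_toLp_ae_eq hf₁ hf₂)).1 (Lp.memLp _)

theorem norm_sq_toLp_eq_integral {f : ℝ → ℂ} (hf : MemLp f 2) :
    ‖hf.toLp f‖ ^ 2 = ∫ x, ‖f x‖ ^ 2 := by
  rw [@norm_sq_eq_re_inner ℂ, L2.inner_def, ← integral_re (L2.integrable_inner _ _)]
  refine integral_congr_ae ?_
  filter_upwards [hf.coeFn_toLp] with x hx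
  rw [hx, ← @norm_sq_eq_re_inner ℂ]

theorem integral_norm_sq_fourier {f : ℝ → ℂ} (hf₁ : Integrable f) (hf₂ : MemLp f 2) :
    ∫ ξ, ‖𝓕 f ξ‖ ^ 2 = ∫ x, ‖f x‖ ^ 2 := by
  have htoLp : (memLp_fourier hf₁ hf₂).toLp (𝓕 f) = 𝓕 (hf₂.toLp f) :=
    Lp.ext ((MemLp.coeFn_toLp _).trans (fourier_toLp_ae_eq hf₁ hf₂).symm)
  rw [← norm_sq_toLp_eq_integral (memLp_fourier hf₁ hf₂), htoLp, Lp.norm_fourier_eq,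
    norm_sq_toLp_eq_integral]

/-- The Fourier–Laplace transform `∫₀^∞ e^{izt} f(t) dt` of a function on the half-line, for `z` in
the upper half-plane. It turns a unitary group into the resolvent of its generator. -/
def fourierLaplace (f : ℝ → ℂ) (z : ℂ) : ℂ :=
  ∫ t in Set.Ioi (0 : ℝ), Complex.exp (Complex.I * z * t) * f t

theorem norm_exp_I_mul (z : ℂ) (t : ℝ) :
    ‖Complex.exp (Complex.I * z * t)‖ = Real.exp (-z.im * t) := by
  simp [Complex.norm_exp]

theorem integrableOn_exp_I_mul {z : ℂ} (hz : 0 < z.im) :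
    IntegrableOn (fun t : ℝ => Complex.exp (Complex.I * z * t)) (Set.Ioi 0) :=
  integrableOn_exp_mul_complex_Ioi (by simpa using hz) 0

variable {f : ℝ → ℂ} {M : ℝ} {z : ℂ}

theorem integrableOn_exp_mul_of_bounded (hf : AEStronglyMeasurable f)
    (hM : ∀ t, ‖f t‖ ≤ M) (hz : 0 < z.im) :
    IntegrableOn (fun t : ℝ => Complex.exp (Complex.I * z * t) * f t) (Set.Ioi 0) :=
  (integrableOn_exp_I_mul hz).mul_bdd hf.restrict (Eventually.of_forall hM)

theorem memLp_two_exp_mul_of_bounded (hf : AEStronglyMeasurable f)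
    (hM : ∀ t, ‖f t‖ ≤ M) (hz : 0 < z.im) :
    MemLp (fun t : ℝ => Complex.exp (Complex.I * z * t) * f t) 2
      (volume.restrict (Set.Ioi (0 : ℝ))) := by
  have hint := integrableOn_exp_mul_of_bounded hf hM hz
  rw [memLp_two_iff_integrable_sq_norm hint.aestronglyMeasurable]
  simp only [sq]
  refine hint.norm.mul_bdd (c := 1 * M) hint.norm.aestronglyMeasurable ?_
  filter_upwards [ae_restrict_mem measurableSet_Ioi] with t ht
  rw [norm_norm, norm_mul, norm_exp_I_mul]
  have : Real.exp (-z.im * t) ≤ 1 := Real.exp_le_one_iff.2 (by nlinarith [Set.mem_Ioi.1 ht])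
  have := hM t
  gcongr

theorem fourierLaplace_eq_fourier (f : ℝ → ℂ) (E ε : ℝ) :
    fourierLaplace f ⟨E, ε⟩ = 𝓕 ((Set.Ioi 0).indicator fun t : ℝ =>
      Complex.exp (Complex.I * (ε * Complex.I) * t) * f t) (-(2 * Real.pi)⁻¹ * E) := by
  rw [Real.fourier_real_eq_integral_exp_smul, fourierLaplace,
    ← integral_indicator measurableSet_Ioi]
  congr 1
  funext t
  by_cases ht : t ∈ Set.Ioi (0 : ℝ)
  · simp only [Set.indicator_of_mem ht, smul_eq_mul, ← mul_assoc, ← Complex.exp_add]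
    congr 2
    rw [Complex.mk_eq_add_mul_I]
    push_cast
    field_simp
  · simp only [Set.indicator_of_notMem ht, smul_zero]

theorem integrable_norm_sq_fourierLaplace (hf : AEStronglyMeasurable f)
    (hM : ∀ t, ‖f t‖ ≤ M) {ε : ℝ} (hε : 0 < ε) :
    Integrable fun E : ℝ => ‖fourierLaplace f ⟨E, ε⟩‖ ^ 2 := by
  have hz : 0 < (ε * Complex.I).im := by simpa using hε
  simp only [fourierLaplace_eq_fourier]
  refine Integrable.comp_mul_left' (g := fun ξ => ‖𝓕 (_ : ℝ → ℂ) ξ‖ ^ 2) (R := -(2 * Real.pi)⁻¹)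
    (MemLp.integrable_norm_pow (memLp_fourier
      ((integrable_indicator_iff measurableSet_Ioi).2 (integrableOn_exp_mul_of_bounded hf hM hz))
      ((memLp_indicator_iff_restrict measurableSet_Ioi).2
        (memLp_two_exp_mul_of_bounded hf hM hz))) two_ne_zero) ?_
  simp [Real.pi_ne_zero]

theorem integral_norm_sq_fourierLaplace (hf : AEStronglyMeasurable f)
    (hM : ∀ t, ‖f t‖ ≤ M) {ε : ℝ} (hε : 0 < ε) :
    ∫ E : ℝ, ‖fourierLaplace f ⟨E, ε⟩‖ ^ 2
      = 2 * Real.pi * ∫ t in Set.Ioi (0 : ℝ), Real.exp (-2 * ε * t) * ‖f t‖ ^ 2 := by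
  have hz : 0 < (ε * Complex.I).im := by simpa using hε
  simp only [fourierLaplace_eq_fourier]
  rw [Measure.integral_comp_mul_left (fun ξ => ‖𝓕 (_ : ℝ → ℂ) ξ‖ ^ 2), integral_norm_sq_fourier
    ((integrable_indicator_iff measurableSet_Ioi).2 (integrableOn_exp_mul_of_bounded hf hM hz))
    ((memLp_indicator_iff_restrict measurableSet_Ioi).2
      (memLp_two_exp_mul_of_bounded hf hM hz)), smul_eq_mul, inv_neg, inv_inv, abs_neg,
    abs_of_pos (by positivity), ← integral_indicator measurableSet_Ioi]
  congr 2
  funext t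
  by_cases ht : t ∈ Set.Ioi (0 : ℝ)
  · simp only [Set.indicator_of_mem ht, norm_mul, norm_exp_I_mul, mul_pow, ← Real.exp_nat_mul]
    simp [mul_assoc]
  · simp [Set.indicator_of_notMem ht]

theorem fourierLaplace_charFun_neg (μ : Measure ℝ) [IsFiniteMeasure μ] (hz : 0 < z.im) :
    fourierLaplace (fun t => charFun μ (-t)) z = -Complex.I * ∫ x, ((x : ℂ) - z)⁻¹ ∂μ := by
  have hprod : Integrable (fun p : ℝ × ℝ => Complex.exp (Complex.I * z * p.1)
      * Complex.exp (((-p.1 : ℝ) : ℂ) * p.2 * Complex.I))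
      ((volume.restrict (Set.Ioi 0)).prod μ) := by
    have hexp : Integrable (fun p : ℝ × ℝ => Complex.exp (Complex.I * z * p.1) * 1)
        ((volume.restrict (Set.Ioi 0)).prod μ) :=
      Integrable.mul_prod (integrableOn_exp_I_mul hz) (integrable_const (μ := μ) (1 : ℂ))
    refine hexp.mono (Continuous.aestronglyMeasurable (by fun_prop)) (Eventually.of_forall ?_)
    intro p
    rw [norm_mul, norm_mul, ← Complex.ofReal_mul, Complex.norm_exp_ofReal_mul_I, norm_one]
  have hinner : ∀ x : ℝ, ∫ t in Set.Ioi (0 : ℝ), Complex.exp (Complex.I * z * t)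
      * Complex.exp (((-t : ℝ) : ℂ) * x * Complex.I) = -Complex.I * ((x : ℂ) - z)⁻¹ := by
    intro x
    have hexp : ∀ t : ℝ, Complex.exp (Complex.I * z * t)
        * Complex.exp (((-t : ℝ) : ℂ) * x * Complex.I)
        = Complex.exp (Complex.I * (z - x) * t) := fun t => by
      rw [← Complex.exp_add]
      push_cast
      ring_nf
    simp only [hexp]
    rw [integral_exp_mul_complex_Ioi (by simpa using hz), Complex.ofReal_zero, mul_zero,
      Complex.exp_zero, ← neg_sub z, inv_neg, mul_neg, neg_mul, neg_neg, neg_div, one_div,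
      mul_inv, Complex.inv_I, neg_mul, neg_neg]
  simp only [fourierLaplace, charFun_apply_real, ← integral_const_mul]
  rw [integral_integral_swap hprod]
  simp only [hinner]

end Fourier

/-! ### Self-adjoint operators -/

section SelfAdjoint

variable {W : Type*} [NormedAddCommGroup W] [InnerProductSpace ℂ W] {H : W →ₗ.[ℂ] W} {z : ℂ}

theorem im_inner_self_apply_eq_zero (hH : H.IsFormalAdjoint H) (g : H.domain) :
    (inner ℂ (g : W) (H g)).im = 0 := by
  rw [← Complex.conj_eq_iff_im, inner_conj_symm]
  exact hH g g

theorem abs_im_mul_norm_le (hH : H.IsFormalAdjoint H) (z : ℂ) (g : H.domain) :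
    |z.im| * ‖(g : W)‖ ≤ ‖H g - z • (g : W)‖ := by
  rcases eq_or_ne (g : W) 0 with hg | hg
  · simp [hg]
  have him : (inner ℂ (g : W) (H g - z • (g : W))).im = -(z.im * ‖(g : W)‖ ^ 2) := by
    rw [inner_sub_right, inner_smul_right, inner_self_eq_norm_sq_to_K, Complex.sub_im,
      im_inner_self_apply_eq_zero hH, zero_sub]
    simp only [Complex.coe_algebraMap, ← Complex.ofReal_pow, Complex.im_mul_ofReal]
  refine le_of_mul_le_mul_left ?_ (norm_pos_iff.2 hg)
  calc ‖(g : W)‖ * (|z.im| * ‖(g : W)‖) = |(inner ℂ (g : W) (H g - z • (g : W))).im| := by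
        rw [him, abs_neg, abs_mul, abs_of_nonneg (sq_nonneg ‖(g : W)‖)]
        ring
    _ ≤ ‖inner ℂ (g : W) (H g - z • (g : W))‖ := Complex.abs_im_le_norm _
    _ ≤ ‖(g : W)‖ * ‖H g - z • (g : W)‖ := norm_inner_le_norm _ _

variable [CompleteSpace W]

theorem isFormalAdjoint_of_isSelfAdjoint (hH : IsSelfAdjoint H) : H.IsFormalAdjoint H := by
  have h := LinearPMap.adjoint_isFormalAdjoint hH.dense_domain
  rwa [LinearPMap.isSelfAdjoint_def.1 hH] at h

theorem isClosed_range_sub_smul (hH : H.IsFormalAdjoint H) (hclosed : H.IsClosed)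
    (hz : z.im ≠ 0) : IsClosed (Set.range fun g : H.domain => H g - z • (g : W)) := by
  have : CompleteSpace H.graph := (_root_.IsClosed.isComplete hclosed).completeSpace_coe
  let D : H.graph →L[ℂ] W :=
    (ContinuousLinearMap.snd ℂ W W - z • ContinuousLinearMap.fst ℂ W W).comp H.graph.subtypeL
  have hD : ∀ p : H.graph, ‖p‖ ≤ (1 + (1 + ‖z‖₊) / ‖z.im‖₊ : NNReal) * ‖D p‖ := by
    rintro ⟨p, hp⟩
    obtain ⟨g, hg, hHg⟩ := (LinearPMap.mem_graph_iff H).1 hp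
    have hDp : D ⟨p, hp⟩ = H g - z • (g : W) := by rw [hg, hHg]; rfl
    have hg_le : ‖(g : W)‖ ≤ ‖D ⟨p, hp⟩‖ / ‖z.im‖ := by
      rw [le_div_iff₀' (norm_pos_iff.2 hz), hDp]
      exact abs_im_mul_norm_le hH z g
    have hHg_le : ‖H g‖ ≤ ‖D ⟨p, hp⟩‖ + ‖z‖ * ‖(g : W)‖ := by
      rw [← norm_smul, hDp]
      exact norm_le_norm_sub_add _ _
    have hbound : (1 + (1 + ‖z‖) / ‖z.im‖) * ‖D ⟨p, hp⟩‖
        = ‖D ⟨p, hp⟩‖ + ‖D ⟨p, hp⟩‖ / ‖z.im‖ + ‖z‖ * (‖D ⟨p, hp⟩‖ / ‖z.im‖) := by ring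
    push_cast
    rw [Submodule.coe_norm, Prod.norm_def, ← hg, ← hHg, hbound]
    have := mul_le_mul_of_nonneg_left hg_le (norm_nonneg z)
    have := mul_nonneg (norm_nonneg z) (norm_nonneg (g : W))
    refine max_le ?_ ?_ <;> linarith [norm_nonneg (D ⟨p, hp⟩), norm_nonneg (g : W)]
  convert (D.antilipschitz_of_bound hD).isClosed_range D.uniformContinuous using 1
  ext w
  constructor
  · rintro ⟨g, rfl⟩
    exact ⟨⟨_, H.mem_graph g⟩, rfl⟩
  · rintro ⟨⟨p, hp⟩, rfl⟩
    obtain ⟨g, hg, hHg⟩ := (LinearPMap.mem_graph_iff H).1 hp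
    exact ⟨g, by simp only [hg, hHg]; rfl⟩

theorem eq_zero_of_inner_sub_smul_eq_zero (hH : IsSelfAdjoint H) (hz : z.im ≠ 0) {η : W}
    (hη : ∀ x : H.domain, inner ℂ η (H x - z • (x : W)) = 0) : η = 0 := by
  have hadj : ∀ x : H.domain, inner ℂ ((starRingEnd ℂ) z • η) (x : W) = inner ℂ η (H x) := by
    intro x
    rw [inner_smul_left, Complex.conj_conj, eq_comm, ← sub_eq_zero, ← inner_smul_right,
      ← inner_sub_right, hη]
  have hmem : η ∈ H.domain := by
    rw [← LinearPMap.isSelfAdjoint_def.1 hH]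
    exact H.mem_adjoint_domain_of_exists η ⟨_, hadj⟩
  have hformal := isFormalAdjoint_of_isSelfAdjoint hH
  have happly : H ⟨η, hmem⟩ = (starRingEnd ℂ) z • η :=
    hH.dense_domain.eq_of_inner_left ℂ fun x hx =>
      (hformal ⟨η, hmem⟩ ⟨x, hx⟩).trans (hadj ⟨x, hx⟩).symm
  have hbound := abs_im_mul_norm_le hformal ((starRingEnd ℂ) z) ⟨η, hmem⟩
  rw [happly, sub_self, norm_zero, Complex.conj_im, abs_neg] at hbound
  exact norm_le_zero_iff.1 (nonpos_of_mul_nonpos_right hbound (abs_pos.2 hz))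

theorem exists_resolvent (hH : IsSelfAdjoint H) (hz : z.im ≠ 0) (ψ : W) :
    ∃ g : H.domain, H g - z • (g : W) = ψ := by
  let R : Submodule ℂ W := LinearMap.range (H.toFun - z • H.domain.subtype)
  have hR : IsClosed (R : Set W) :=
    isClosed_range_sub_smul (isFormalAdjoint_of_isSelfAdjoint hH) hH.isClosed hz
  have : CompleteSpace R := hR.completeSpace_coe
  have hbot : Rᗮ = ⊥ := (Submodule.eq_bot_iff _).2 fun η hη =>
    eq_zero_of_inner_sub_smul_eq_zero hH hz fun x =>
      Submodule.inner_left_of_mem_orthogonal (LinearMap.mem_range_self _ x) hη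
  have hψ : ψ ∈ R := by rw [Submodule.orthogonal_eq_bot_iff.1 hbot]; trivial
  exact hψ

end SelfAdjoint

section Polarization

variable {W : Type*} [NormedAddCommGroup W] [InnerProductSpace ℂ W]

theorem sum_polarization (φ ψ p q : W) :
    (1 / 4) * ∑ k ∈ Finset.range 4,
      (-Complex.I) ^ k * inner ℂ (φ + Complex.I ^ k • ψ) (p + Complex.I ^ k • q)
      = inner ℂ φ q := by
  have hI3 : Complex.I ^ 3 = -Complex.I := Complex.I_pow_three
  simp only [inner_add_left, inner_add_right, inner_smul_left, inner_smul_right, map_pow,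
    Complex.conj_I, Finset.sum_range_succ, Finset.sum_range_zero]
  simp only [neg_pow Complex.I, hI3, Complex.I_sq, pow_zero, pow_one]
  linear_combination (-(1 / 2) * inner ℂ φ q + (1 / 2) * inner ℂ ψ p) * Complex.I_sq

end Polarization

section Hamiltonian

variable {d : ℕ} (V : (Fin d → ℤ) → ℝ)

theorem inner_delta (n : Fin d → ℤ) (g : L2 d) : inner ℂ (delta V n : L2 d) g = g n :=
  (lp.inner_single_left (G := fun _ : Fin d → ℤ => ℂ) n 1 g).trans (by simp)

theorem tendsto_norm_boxMatrix_sub_restr (g : (hamiltonian V).domain) :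
    Tendsto (fun F => ‖Matrix.toEuclideanLin (boxMatrix V F) (restr F (g : L2 d))
      - restr F (hamiltonian V g)‖) atTop (𝓝 0) := by
  have hnorm : Tendsto (fun F => ‖restr F (g : L2 d)‖ ^ 2) atTop (𝓝 (‖(g : L2 d)‖ ^ 2)) :=
    Tendsto.congr (fun F => (norm_restr_sq F _).symm) (hasSum_norm_sq (g : L2 d))
  have hsqrt := ((hnorm.const_sub (‖(g : L2 d)‖ ^ 2)).const_mul ((3 ^ d : ℝ) ^ 2)).sqrt
  rw [sub_self, mul_zero, Real.sqrt_zero] at hsqrt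
  exact squeeze_zero (fun _ => norm_nonneg _)
    (fun F => Real.le_sqrt_of_sq_le (boxMatrix_error V F g)) hsqrt

theorem tendsto_inner_restr_boxMatrix (φ : L2 d) (g : (hamiltonian V).domain) :
    Tendsto (fun F => inner ℂ (restr F φ)
      (Matrix.toEuclideanLin (boxMatrix V F) (restr F (g : L2 d)))) atTop
      (𝓝 (inner ℂ φ (hamiltonian V g))) := by
  have herror : Tendsto (fun F => inner ℂ (restr F φ)
      (Matrix.toEuclideanLin (boxMatrix V F) (restr F (g : L2 d)) - restr F (hamiltonian V g)))
      atTop (𝓝 0) := by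
    refine squeeze_zero_norm (fun F => (norm_inner_le_norm _ _).trans
      (mul_le_mul_of_nonneg_right (norm_restr_le F φ) (norm_nonneg _))) ?_
    simpa using (tendsto_norm_boxMatrix_sub_restr V g).const_mul ‖φ‖
  simpa [inner_sub_right] using herror.add (tendsto_inner_restr φ (hamiltonian V g))

theorem isFormalAdjoint_hamiltonian : (hamiltonian V).IsFormalAdjoint (hamiltonian V) := by
  intro φ g
  have hstar := (Complex.continuous_conj.tendsto _).comp (tendsto_inner_restr_boxMatrix V g φ)
  rw [inner_conj_symm] at hstar
  refine tendsto_nhds_unique (hstar.congr fun F => ?_) (tendsto_inner_restr_boxMatrix V φ g)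
  rw [Function.comp_apply, inner_conj_symm]
  exact Matrix.isSymmetric_toEuclideanLin_iff.2 (boxMatrix_isHermitian V F) _ _

theorem dense_domain_hamiltonian : Dense ((hamiltonian V).domain : Set (L2 d)) := by
  rw [Submodule.dense_iff_topologicalClosure_eq_top, Submodule.topologicalClosure_eq_top_iff,
    Submodule.eq_bot_iff]
  intro g hg
  ext n
  rw [← inner_delta V n g, Submodule.inner_right_of_mem_orthogonal (delta V n).2 hg]
  rfl

theorem delta_apply (n m : Fin d → ℤ) : (delta V n : L2 d) m = if m = n then 1 else 0 := by
  change lp.single (E := fun _ : Fin d → ℤ => ℂ) 2 n 1 m = _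
  rw [lp.single_apply, Pi.single_apply]

theorem hamiltonian_delta (n : Fin d → ℤ) : hamiltonian V (delta V n)
    = ∑ m ∈ neighbors n, (delta V m : L2 d) + (V n : ℂ) • (delta V n : L2 d) := by
  ext m
  rw [hamiltonian_apply, lp.coeFn_add, lp.coeFn_sum, lp.coeFn_smul]
  change ∑ k ∈ neighbors m, (delta V n : L2 d) k + (V m : ℂ) * (delta V n : L2 d) m = _
  simp only [Pi.add_apply, Finset.sum_apply, Pi.smul_apply, delta_apply, smul_eq_mul,
    Finset.sum_ite_eq, Finset.sum_ite_eq', mem_neighbors_comm (n := n)]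
  by_cases h : m = n <;> simp [h]

theorem action_eq_inner_hamiltonian_delta (n : Fin d → ℤ) (g : L2 d) :
    action V g n = inner ℂ (hamiltonian V (delta V n)) g := by
  simp only [hamiltonian_delta, inner_add_left, sum_inner, inner_smul_left, inner_delta,
    Complex.conj_ofReal]
  rfl

theorem isSelfAdjoint_hamiltonian : IsSelfAdjoint (hamiltonian V) := by
  rw [LinearPMap.isSelfAdjoint_def]
  refine le_antisymm ?_
    ((isFormalAdjoint_hamiltonian V).le_adjoint (dense_domain_hamiltonian V))
  have hadj := LinearPMap.adjoint_isFormalAdjoint (dense_domain_hamiltonian V)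
  have haction : ∀ η : (hamiltonian V).adjoint.domain,
      action V (η : L2 d) = ((hamiltonian V).adjoint η : L2 d) := by
    intro η
    funext n
    rw [action_eq_inner_hamiltonian_delta, ← inner_delta V n]
    exact (hadj.symm (delta V n) η)
  refine ⟨fun η hη => ?_, fun η g hηg => lp.ext ?_⟩
  · change Memℓp (action V η) 2
    rw [haction ⟨η, hη⟩]
    exact lp.memℓp _
  · rw [hamiltonian_apply, ← haction η, hηg]

end Hamiltonian

/-! ### Tridiagonal form of a symmetric operator in a Gram–Schmidt basis -/

section GramSchmidt

open InnerProductSpace Submodule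

theorem linearIndependent_of_dual_triangular {ι K M : Type*} [LinearOrder ι] [Field K]
    [AddCommGroup M] [Module K M] {v : ι → M} (φ : ι → Module.Dual K M)
    (hne : ∀ i, φ i (v i) ≠ 0) (hlt : ∀ i j, j < i → φ i (v j) = 0) :
    LinearIndependent K v := by
  classical
  refine linearIndependent_iff'.2 fun s c hsum => ?_
  by_contra! hc
  obtain ⟨i, hi, hmax⟩ := (s.filter (c · ≠ 0)).exists_max_image id
    (hc.imp fun i hi => Finset.mem_filter.2 hi)
  rw [Finset.mem_filter] at hi
  have heval : ∑ j ∈ s, c j * φ i (v j) = 0 := by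
    simpa only [map_sum, map_smul, smul_eq_mul, map_zero] using congrArg (φ i) hsum
  rw [Finset.sum_eq_single_of_mem i hi.1] at heval
  · exact mul_ne_zero hi.2 (hne i) heval
  · intro j hj hji
    by_cases hcj : c j = 0
    · rw [hcj, zero_mul]
    · rw [hlt i j (lt_of_le_of_ne (hmax j (Finset.mem_filter.2 ⟨hj, hcj⟩)) hji), mul_zero]

variable {𝕜 W : Type*} [RCLike 𝕜] [NormedAddCommGroup W] [InnerProductSpace 𝕜 W]

theorem sum_inner_smul_of_mem_span {ι : Type*} {v : ι → W} (hv : Orthonormal 𝕜 v)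
    {s : Finset ι} {x : W} (hx : x ∈ span 𝕜 (v '' s)) : ∑ i ∈ s, inner 𝕜 (v i) x • v i = x := by
  classical
  obtain ⟨c, rfl⟩ := (mem_span_image_finset_iff_exists_fun' 𝕜).1 hx
  exact Finset.sum_congr rfl fun i hi => by rw [hv.inner_right_sum c hi]

theorem inner_eq_zero_of_mem_span {s : Set W} {x y : W} (hx : x ∈ span 𝕜 s)
    (h : ∀ z ∈ s, inner 𝕜 y z = 0) : inner 𝕜 y x = 0 := by
  have hs : span 𝕜 s ≤ (𝕜 ∙ y)ᗮ :=
    span_le.2 fun z hz => mem_orthogonal_singleton_iff_inner_right.2 (h z hz)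
  exact mem_orthogonal_singleton_iff_inner_right.1 (hs hx)

theorem apply_mem_span_image {E F ι : Type*} [AddCommGroup E] [Module 𝕜 E] [AddCommGroup F]
    [Module 𝕜 F] {H : E →ₗ.[𝕜] F} {f : ι → H.domain} {s : Set ι} {x : H.domain}
    (hx : (x : E) ∈ span 𝕜 ((fun i => (f i : E)) '' s)) :
    H x ∈ span 𝕜 ((fun i => H (f i)) '' s) := by
  have hxf : x ∈ span 𝕜 (f '' s) := by
    rw [← Function.comp_def, Set.image_comp] at hx
    change H.domain.subtype x ∈ span 𝕜 (H.domain.subtype '' (f '' s)) at hx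
    rwa [span_image, ← Submodule.mem_comap,
      comap_map_eq_of_injective H.domain.injective_subtype] at hx
  have hHx := mem_map_of_mem (f := H.toFun) hxf
  rwa [← span_image, ← Set.image_comp] at hHx

section Orthogonalization

variable {ι : Type*} [LinearOrder ι] [LocallyFiniteOrderBot ι] [WellFoundedLT ι] (v : ι → W)

theorem inner_gramSchmidt_eq_zero_of_mem_span {k : ι} {x : W}
    (hx : x ∈ span 𝕜 (v '' Set.Iio k)) : inner 𝕜 (gramSchmidt 𝕜 v k) x = 0 :=
  inner_eq_zero_of_mem_span hx <| by
    rintro _ ⟨j, hj, rfl⟩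
    exact gramSchmidt_inv_triangular 𝕜 v hj

theorem sub_gramSchmidt_mem_span (k : ι) :
    v k - gramSchmidt 𝕜 v k ∈ span 𝕜 (v '' Set.Iio k) := by
  rw [← span_gramSchmidt_Iio 𝕜 v k, sub_eq_of_eq_add' (gramSchmidt_def' 𝕜 v k)]
  refine sum_mem fun i hi => ?_
  rw [starProjection_singleton]
  exact smul_mem _ _ (subset_span ⟨i, Finset.mem_Iio.1 hi, rfl⟩)

theorem inner_gramSchmidt_self (k : ι) :
    inner 𝕜 (gramSchmidt 𝕜 v k) (v k) = ((‖gramSchmidt 𝕜 v k‖ ^ 2 : ℝ) : 𝕜) := by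
  have h := inner_gramSchmidt_eq_zero_of_mem_span v (sub_gramSchmidt_mem_span (𝕜 := 𝕜) v k)
  rw [inner_sub_right, sub_eq_zero] at h
  rw [h, inner_self_eq_norm_sq_to_K, RCLike.ofReal_pow]

theorem span_gramSchmidtNormed_Iic (k : ι) :
    span 𝕜 (gramSchmidtNormed 𝕜 v '' Set.Iic k) = span 𝕜 (v '' Set.Iic k) := by
  rw [span_gramSchmidtNormed, span_gramSchmidt_Iic]

theorem gramSchmidtNormed_mem_span (k : ι) :
    gramSchmidtNormed 𝕜 v k ∈ span 𝕜 (v '' Set.Iic k) := by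
  rw [← span_gramSchmidtNormed_Iic]
  exact subset_span ⟨k, le_rfl, rfl⟩

end Orthogonalization

section Krylov

variable {H : W →ₗ.[𝕜] W} {f r : ℕ → H.domain}

theorem apply_gramSchmidtNormed_mem_span (hf : ∀ k, H (f k) = f (k + 1))
    (hr : ∀ k, (r k : W) = gramSchmidtNormed 𝕜 (fun k => (f k : W)) k) (k : ℕ) :
    H (r k) ∈ span 𝕜 ((fun k => (r k : W)) '' Set.Iic (k + 1)) := by
  have hHr := apply_mem_span_image (hr k ▸ gramSchmidtNormed_mem_span (𝕜 := 𝕜) _ k)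
  simp only [hr, span_gramSchmidtNormed_Iic]
  refine span_mono ?_ hHr
  rintro _ ⟨j, hj, rfl⟩
  exact ⟨j + 1, Nat.succ_le_succ hj, (hf j).symm⟩

theorem inner_gramSchmidtNormed_succ_apply (hf : ∀ k, H (f k) = f (k + 1))
    (hr : ∀ k, (r k : W) = gramSchmidtNormed 𝕜 (fun k => (f k : W)) k) (k : ℕ) :
    inner 𝕜 (r (k + 1) : W) (H (r k))
      = ((‖gramSchmidt 𝕜 (fun k => (f k : W)) (k + 1)‖
          / ‖gramSchmidt 𝕜 (fun k => (f k : W)) k‖ : ℝ) : 𝕜) := by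
  set v : ℕ → W := fun k => (f k : W)
  set c : 𝕜 := (‖gramSchmidt 𝕜 v k‖ : 𝕜)⁻¹ with hc
  have hlow : ((c • f k - r k : H.domain) : W) ∈ span 𝕜 (v '' Set.Iio k) := by
    rw [H.domain.coe_sub, hr, gramSchmidtNormed, H.domain.coe_smul, ← smul_sub]
    exact smul_mem _ _ (sub_gramSchmidt_mem_span v k)
  have horth : inner 𝕜 (gramSchmidt 𝕜 v (k + 1)) (H (c • f k - r k)) = 0 := by
    refine inner_gramSchmidt_eq_zero_of_mem_span v (span_mono ?_ (apply_mem_span_image hlow))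
    rintro _ ⟨j, hj, rfl⟩
    exact ⟨j + 1, Nat.succ_lt_succ hj, (hf j).symm⟩
  rw [H.map_sub, H.map_smul, hf, inner_sub_right, sub_eq_zero, inner_smul_right,
    show (f (k + 1) : W) = v (k + 1) from rfl, inner_gramSchmidt_self] at horth
  rw [hr, gramSchmidtNormed, inner_smul_left, ← horth, map_inv₀, RCLike.conj_ofReal, hc]
  push_cast
  rcases eq_or_ne (‖gramSchmidt 𝕜 v (k + 1)‖ : 𝕜) 0 with h | h
  · simp [h]
  · field_simp

end Krylov

section Tridiagonal

variable {H : W →ₗ.[𝕜] W} {r : ℕ → H.domain}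

theorem inner_apply_eq_zero_of_add_one_lt (ho : Orthonormal 𝕜 fun k => (r k : W))
    (hspan : ∀ k, H (r k) ∈ span 𝕜 ((fun k => (r k : W)) '' Set.Iic (k + 1))) {j k : ℕ}
    (hjk : k + 1 < j) : inner 𝕜 (r j : W) (H (r k)) = 0 :=
  inner_eq_zero_of_mem_span (hspan k) <| by
    rintro _ ⟨i, hi, rfl⟩
    exact ho.2 (lt_of_le_of_lt hi hjk).ne'

theorem sum_inner_smul_apply (ho : Orthonormal 𝕜 fun k => (r k : W))
    (hspan : ∀ k, H (r k) ∈ span 𝕜 ((fun k => (r k : W)) '' Set.Iic (k + 1))) (k : ℕ) :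
    ∑ j ∈ Finset.range (k + 2), inner 𝕜 (r j : W) (H (r k)) • (r j : W) = H (r k) := by
  refine sum_inner_smul_of_mem_span ho ?_
  rw [Nat.range_succ_eq_Iic, Finset.coe_Iic]
  exact hspan k

theorem apply_zero_eq_add (ho : Orthonormal 𝕜 fun k => (r k : W))
    (hspan : ∀ k, H (r k) ∈ span 𝕜 ((fun k => (r k : W)) '' Set.Iic (k + 1))) :
    H (r 0) = inner 𝕜 (r 0 : W) (H (r 0)) • (r 0 : W)
      + inner 𝕜 (r 1 : W) (H (r 0)) • (r 1 : W) := by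
  conv_lhs => rw [← sum_inner_smul_apply ho hspan 0, Finset.sum_range_succ, Finset.sum_range_one]

theorem apply_succ_eq_add (hH : H.IsFormalAdjoint H) (ho : Orthonormal 𝕜 fun k => (r k : W))
    (hspan : ∀ k, H (r k) ∈ span 𝕜 ((fun k => (r k : W)) '' Set.Iic (k + 1))) (k : ℕ) :
    H (r (k + 1)) = inner 𝕜 (r k : W) (H (r (k + 1))) • (r k : W)
      + inner 𝕜 (r (k + 1) : W) (H (r (k + 1))) • (r (k + 1) : W)
      + inner 𝕜 (r (k + 2) : W) (H (r (k + 1))) • (r (k + 2) : W) := by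
  have hlow : ∀ j < k, inner 𝕜 (r j : W) (H (r (k + 1))) = 0 := fun j hj => by
    rw [← hH, ← inner_conj_symm,
      inner_apply_eq_zero_of_add_one_lt ho hspan (Nat.succ_lt_succ hj), map_zero]
  conv_lhs => rw [← sum_inner_smul_apply ho hspan (k + 1)]
  rw [Finset.sum_range_succ, Finset.sum_range_succ, Finset.sum_range_succ,
    Finset.sum_eq_zero fun j hj => by rw [hlow j (Finset.mem_range.1 hj), zero_smul], zero_add]

end Tridiagonal

end GramSchmidt

/-! ### The tridiagonal representation of the Hamiltonian -/

section OrthonormalPolynomials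

open InnerProductSpace
open scoped ComplexOrder

variable {d : ℕ} (V : (Fin d → ℤ) → ℝ)

section Locality

theorem siteNorm_le_add_one_of_mem_neighbors {n m : Fin d → ℤ} (h : m ∈ neighbors n) :
    siteNorm n ≤ siteNorm m + 1 := by
  rw [← mem_neighbors.1 h, siteNorm, siteNorm, siteNorm, ← Finset.sum_add_distrib]
  exact Finset.sum_le_sum fun i _ => by simpa using abs_add_le (m i) (n i - m i)

theorem action_apply (ψ : (Fin d → ℤ) → ℂ) (n : Fin d → ℤ) :
    action V ψ n = ∑ m ∈ neighbors n, ψ m + V n * ψ n := rfl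

theorem moment_succ (k : ℕ) : (moment V (k + 1) : (Fin d → ℤ) → ℂ) = action V (moment V k) :=
  Function.iterate_succ_apply' _ _ _

theorem moment_zero : moment V 0 = (delta V 0 : L2 d) := by
  ext n
  rw [delta_apply]
  exact Pi.single_apply 0 (1 : ℂ) n

theorem moment_apply_eq_zero (k : ℕ) {n : Fin d → ℤ} (hn : k < siteNorm n) :
    moment V k n = 0 := by
  induction k generalizing n with
  | zero =>
    rw [moment_zero, delta_apply, if_neg]
    rintro rfl
    simp [siteNorm] at hn
  | succ k ih =>
    push_cast at hn
    rw [moment_succ, action_apply, ih (by omega), mul_zero, add_zero]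
    refine Finset.sum_eq_zero fun m hm => ih ?_
    linarith [siteNorm_le_add_one_of_mem_neighbors hm]

theorem moment_succ_apply {k : ℕ} {n : Fin d → ℤ} (hn : k < siteNorm n) :
    moment V (k + 1) n = ∑ m ∈ neighbors n, moment V k m := by
  rw [moment_succ, action_apply, moment_apply_eq_zero V k hn, mul_zero, add_zero]

theorem moment_apply_nonneg (k : ℕ) {n : Fin d → ℤ} (hn : k ≤ siteNorm n) :
    0 ≤ moment V k n := by
  induction k generalizing n with
  | zero =>
    rw [moment_zero, delta_apply]
    split_ifs <;> simp
  | succ k ih =>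
    push_cast at hn
    rw [moment_succ_apply V (by omega)]
    refine Finset.sum_nonneg fun m hm => ih ?_
    linarith [siteNorm_le_add_one_of_mem_neighbors hm]

/-- The site at distance `k` from the origin on the first coordinate axis, where the `k`-th moment
vector does not vanish. -/
def axis (hd : 0 < d) (k : ℕ) : Fin d → ℤ := Pi.single ⟨0, hd⟩ (k : ℤ)

theorem siteNorm_axis (hd : 0 < d) (k : ℕ) : siteNorm (axis hd k) = k := by
  rw [siteNorm, Finset.sum_eq_single_of_mem ⟨0, hd⟩ (Finset.mem_univ _)]
  · simp [axis]
  · intro i _ hi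
    simp [axis, Pi.single_eq_of_ne hi]

theorem axis_mem_neighbors (hd : 0 < d) (k : ℕ) : axis hd k ∈ neighbors (axis hd (k + 1)) := by
  have hsub : axis hd (k + 1) - axis hd k = axis hd 1 := by
    rw [axis, axis, axis, ← Pi.single_sub]
    congr 1
    push_cast
    ring
  rw [mem_neighbors, hsub, siteNorm_axis, Nat.cast_one]

theorem moment_apply_axis_pos (hd : 0 < d) (k : ℕ) : 0 < moment V k (axis hd k) := by
  induction k with
  | zero =>
    rw [moment_zero, delta_apply, if_pos (by simp [axis])]
    exact zero_lt_one
  | succ k ih =>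
    have hk : (k : ℤ) < siteNorm (axis hd (k + 1)) := by
      rw [siteNorm_axis]
      exact_mod_cast k.lt_succ_self
    rw [moment_succ_apply V hk]
    refine Finset.sum_pos' (fun m hm => moment_apply_nonneg V k ?_)
      ⟨_, axis_mem_neighbors hd k, ih⟩
    linarith [siteNorm_le_add_one_of_mem_neighbors hm]

theorem linearIndependent_moment (hd : 0 < d) : LinearIndependent ℂ (moment V) := by
  refine linearIndependent_of_dual_triangular
    (fun k => innerₛₗ ℂ (delta V (axis hd k) : L2 d)) (fun k => ?_) (fun k j hj => ?_)
  · rw [innerₛₗ_apply_apply, inner_delta]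
    exact (moment_apply_axis_pos V hd k).ne'
  · rw [innerₛₗ_apply_apply, inner_delta]
    exact moment_apply_eq_zero V j (by rw [siteNorm_axis]; exact_mod_cast hj)

end Locality

theorem orthonormal_delta : Orthonormal ℂ fun n => (delta V n : L2 d) := by
  classical
  refine orthonormal_iff_ite.2 fun n m => ?_
  rw [inner_delta, delta_apply]

theorem rho_zero : rho V 0 = (delta V 0 : L2 d) := by
  rw [rho, gramSchmidtNormed, ← Nat.bot_eq_zero, gramSchmidt_bot, Nat.bot_eq_zero, moment_zero,
    (orthonormal_delta V).1 0]
  simp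

theorem orthonormal_rho (hd : 0 < d) : Orthonormal ℂ (rho V) :=
  gramSchmidtNormed_orthonormal (linearIndependent_moment V hd)

theorem rho_apply_eq_zero (k : ℕ) {n : Fin d → ℤ} (hn : k < siteNorm n) : rho V k n = 0 := by
  rw [← inner_delta V n]
  refine inner_eq_zero_of_mem_span (gramSchmidtNormed_mem_span (moment V) k) ?_
  rintro _ ⟨j, hj, rfl⟩
  rw [inner_delta]
  exact moment_apply_eq_zero V j (lt_of_le_of_lt (by exact_mod_cast hj) hn)

/-- The vector `ρ_k` as an element of the domain of the Hamiltonian. -/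
def rhoVec (k : ℕ) : (hamiltonian V).domain := ⟨rho V k, rho_mem_domain V k⟩

theorem hamiltonian_rhoVec_mem_span (k : ℕ) : hamiltonian V (rhoVec V k)
    ∈ Submodule.span ℂ ((fun k => (rhoVec V k : L2 d)) '' Set.Iic (k + 1)) :=
  apply_gramSchmidtNormed_mem_span
    (f := fun k => ⟨moment V k, mem_domain_of_finite V (iterate_support_finite V k)⟩)
    (fun k => lp.ext (moment_succ V k).symm) (fun _ => rfl) k

theorem inner_rho_succ_hamiltonian_rhoVec (k : ℕ) :
    inner ℂ (rho V (k + 1)) (hamiltonian V (rhoVec V k))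
      = ((‖gramSchmidt ℂ (moment V) (k + 1)‖ / ‖gramSchmidt ℂ (moment V) k‖ : ℝ) : ℂ) :=
  inner_gramSchmidtNormed_succ_apply (r := rhoVec V)
    (f := fun k => ⟨moment V k, mem_domain_of_finite V (iterate_support_finite V k)⟩)
    (fun k => lp.ext (moment_succ V k).symm) (fun _ => rfl) k

theorem polyA_succ (k : ℕ) : polyA V (k + 1)
    = ‖gramSchmidt ℂ (moment V) (k + 1)‖ / ‖gramSchmidt ℂ (moment V) k‖ := by
  change (inner ℂ (rho V (k + 1)) (hamiltonian V (rhoVec V k))).re = _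
  rw [inner_rho_succ_hamiltonian_rhoVec, Complex.ofReal_re]

theorem polyA_ne_zero (hd : 0 < d) (k : ℕ) : polyA V k ≠ 0 := by
  rcases k with _ | k
  · exact one_ne_zero
  · have hne := fun j => norm_ne_zero_iff.2 (gramSchmidt_ne_zero j (linearIndependent_moment V hd))
    rw [polyA_succ]
    exact div_ne_zero (hne _) (hne _)

theorem inner_rho_succ_eq_polyA (k : ℕ) :
    inner ℂ (rho V (k + 1)) (hamiltonian V (rhoVec V k)) = polyA V (k + 1) := by
  rw [inner_rho_succ_hamiltonian_rhoVec, polyA_succ]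

theorem inner_rho_eq_polyA (k : ℕ) :
    inner ℂ (rho V k) (hamiltonian V (rhoVec V (k + 1))) = polyA V (k + 1) := by
  have hsymm : inner ℂ (hamiltonian V (rhoVec V k)) (rho V (k + 1))
      = inner ℂ (rho V k) (hamiltonian V (rhoVec V (k + 1))) :=
    isFormalAdjoint_hamiltonian V (rhoVec V k) (rhoVec V (k + 1))
  rw [← hsymm, ← inner_conj_symm, inner_rho_succ_eq_polyA, Complex.conj_ofReal]

theorem inner_rho_eq_polyB (k : ℕ) :
    inner ℂ (rho V k) (hamiltonian V (rhoVec V k)) = polyB V (k + 1) := by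
  have hsymm : inner ℂ (hamiltonian V (rhoVec V k)) (rho V k)
      = inner ℂ (rho V k) (hamiltonian V (rhoVec V k)) :=
    isFormalAdjoint_hamiltonian V (rhoVec V k) (rhoVec V k)
  rw [eq_comm]
  exact Complex.conj_eq_iff_re.1 ((inner_conj_symm _ _).trans hsymm)

theorem hamiltonian_rhoVec_zero (hd : 0 < d) : hamiltonian V (rhoVec V 0)
    = (polyB V 1 : ℂ) • rho V 0 + (polyA V 1 : ℂ) • rho V 1 := by
  rw [← inner_rho_eq_polyB, ← inner_rho_succ_eq_polyA]
  exact apply_zero_eq_add (r := rhoVec V) (orthonormal_rho V hd) (hamiltonian_rhoVec_mem_span V)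

theorem hamiltonian_rhoVec_succ (hd : 0 < d) (k : ℕ) : hamiltonian V (rhoVec V (k + 1))
    = (polyA V (k + 1) : ℂ) • rho V k + (polyB V (k + 2) : ℂ) • rho V (k + 1)
      + (polyA V (k + 2) : ℂ) • rho V (k + 2) := by
  rw [← inner_rho_eq_polyA, ← inner_rho_eq_polyB, ← inner_rho_succ_eq_polyA]
  exact apply_succ_eq_add (r := rhoVec V) (isFormalAdjoint_hamiltonian V) (orthonormal_rho V hd)
    (hamiltonian_rhoVec_mem_span V) k

/-- The coefficients of `g` in the vectors `ρ_0, ρ_1, …`, shifted by one. For `g = (H - z)⁻¹δ_0` the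
value `-1` at `0` makes the Jacobi recurrence hold at `1`, where `δ_0` contributes. -/
def rhoCoeff (g : L2 d) : ℕ → ℂ
  | 0 => -1
  | n + 1 => inner ℂ (rho V n) g

theorem rhoCoeff_recurrence (hd : 0 < d) {z : ℂ} {g : (hamiltonian V).domain}
    (hg : hamiltonian V g - z • (g : L2 d) = delta V 0) (n : ℕ) :
    polyA V (n + 1) * rhoCoeff V g (n + 2) + polyA V n * rhoCoeff V g n
      + polyB V (n + 1) * rhoCoeff V g (n + 1) = z * rhoCoeff V g (n + 1) := by
  have hHg : inner ℂ (hamiltonian V (rhoVec V n)) (g : L2 d)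
      = inner ℂ (rho V n) (rho V 0) + z * inner ℂ (rho V n) (g : L2 d) := by
    have hsymm : inner ℂ (hamiltonian V (rhoVec V n)) (g : L2 d)
        = inner ℂ (rho V n) (hamiltonian V g) := isFormalAdjoint_hamiltonian V (rhoVec V n) g
    rw [hsymm, sub_eq_iff_eq_add.1 hg, inner_add_right, inner_smul_right, rho_zero]
  rw [orthonormal_iff_ite.1 (orthonormal_rho V hd)] at hHg
  rcases n with _ | n
  · rw [hamiltonian_rhoVec_zero V hd, if_pos rfl] at hHg
    simp only [inner_add_left, inner_smul_left, Complex.conj_ofReal] at hHg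
    simp only [rhoCoeff, polyA] at hHg ⊢
    push_cast
    linear_combination hHg
  · rw [hamiltonian_rhoVec_succ V hd, if_neg n.succ_ne_zero] at hHg
    simp only [inner_add_left, inner_smul_left, Complex.conj_ofReal] at hHg
    simp only [rhoCoeff]
    linear_combination hHg

theorem sum_norm_sq_inner_le_sum {ι : Type*} {v : ι → L2 d} (hv : Orthonormal ℂ v)
    {s : Finset ι} {F : Finset (Fin d → ℤ)} (hsupp : ∀ i ∈ s, ∀ n ∉ F, v i n = 0) (g : L2 d) :
    ∑ i ∈ s, ‖inner ℂ (v i) g‖ ^ 2 ≤ ∑ n ∈ F, ‖g n‖ ^ 2 := by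
  classical
  let χ : L2 d := ∑ n ∈ F, lp.single 2 n (g n)
  have hinner : ∀ i ∈ s, inner ℂ (v i) g = inner ℂ (v i) χ := fun i hi => by
    rw [lp.inner_eq_tsum, inner_sum,
      tsum_eq_sum fun n hn => by rw [hsupp i hi n hn, inner_zero_left]]
    exact Finset.sum_congr rfl fun n _ => (lp.inner_single_right n (g n) (v i)).symm
  have hnorm : ‖χ‖ ^ 2 = ∑ n ∈ F, ‖g n‖ ^ 2 := by
    have h := lp.norm_sum_single (E := fun _ : Fin d → ℤ => ℂ) (p := 2) (by norm_num) g F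
    simpa only [ENNReal.toReal_ofNat, Real.rpow_ofNat] using h
  rw [← hnorm, Finset.sum_congr rfl fun i hi => by rw [hinner i hi]]
  exact hv.sum_inner_products_le χ

theorem sum_norm_sq_inner_rho_le (hd : 0 < d) (g : L2 d) {s : Finset ℕ} {R : ℝ}
    (hs : ∀ k ∈ s, (k : ℝ) < R) : ∑ k ∈ s, ‖inner ℂ (rho V k) g‖ ^ 2 ≤ ballWeight R g := by
  refine sum_norm_sq_inner_le_sum (orthonormal_rho V hd) (fun k hk n hn => ?_) g
  rw [mem_ball, not_lt] at hn
  exact rho_apply_eq_zero V k (by exact_mod_cast (hs k hk).trans_le hn)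

theorem ballWeight_pos {z : ℂ} {g : (hamiltonian V).domain}
    (hg : hamiltonian V g - z • (g : L2 d) = delta V 0) {R : ℝ} (hR : 1 < R) :
    0 < ballWeight R (g : L2 d) := by
  refine lt_of_le_of_ne (Finset.sum_nonneg fun n _ => sq_nonneg _) fun hzero => ?_
  have hvanish : ∀ n : Fin d → ℤ, siteNorm n ≤ 1 → (g : L2 d) n = 0 := fun n hn => by
    have hmem : n ∈ ball d R := mem_ball.2 (lt_of_le_of_lt (by exact_mod_cast hn) hR)
    simpa using (Finset.sum_eq_zero_iff_of_nonneg fun n _ => sq_nonneg _).1 hzero.symm n hmem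
  have haction : action V (g : L2 d) 0 = 0 := by
    rw [action_apply, hvanish 0 (by simp [siteNorm]), mul_zero, add_zero]
    refine Finset.sum_eq_zero fun m hm => hvanish m ?_
    simpa using (mem_neighbors.1 (mem_neighbors_comm.1 hm)).le
  have heq : action V (g : L2 d) 0 - z * (g : L2 d) 0 = (delta V 0 : L2 d) 0 :=
    congrArg (fun φ : L2 d => φ 0) hg
  rw [haction, hvanish 0 (by simp [siteNorm]), delta_apply, if_pos rfl] at heq
  simp at heq

end OrthonormalPolynomials

/-! ### Solutions of the Jacobi recurrence and truncated norms -/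

section QuadraticForm

theorem exists_cos_sin_form_eq (A B C : ℝ) :
    ∃ r φ : ℝ, 0 ≤ r ∧ r ^ 2 = ((A - B) / 2) ^ 2 + C ^ 2 ∧
      ∀ θ, A * Real.cos θ ^ 2 + 2 * C * (Real.sin θ * Real.cos θ) + B * Real.sin θ ^ 2
        = (A + B) / 2 + r * Real.cos (2 * θ - φ) := by
  set ζ : ℂ := ⟨(A - B) / 2, C⟩
  have hcos : ‖ζ‖ * Real.cos ζ.arg = (A - B) / 2 := Complex.norm_mul_cos_arg ζ
  have hsin : ‖ζ‖ * Real.sin ζ.arg = C := Complex.norm_mul_sin_arg ζ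
  refine ⟨‖ζ‖, ζ.arg, norm_nonneg _, ?_, fun θ => ?_⟩
  · rw [Complex.sq_norm, Complex.normSq_apply, sq, sq]
  · rw [Real.cos_sub, Real.cos_two_mul, Real.sin_two_mul]
    linear_combination B * Real.sin_sq_add_cos_sq θ - (2 * Real.cos θ ^ 2 - 1) * hcos
      - 2 * Real.sin θ * Real.cos θ * hsin

theorem iSup_sqrt_add_mul_cos {m r φ : ℝ} (hr : 0 ≤ r) :
    ⨆ θ : ℝ, √(m + r * Real.cos (2 * θ - φ)) = √(m + r) := by
  refine IsGreatest.csSup_eq ⟨⟨φ / 2, ?_⟩, ?_⟩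
  · simp only [mul_div_cancel₀ φ (two_ne_zero' ℝ), sub_self, Real.cos_zero, mul_one]
  · rintro _ ⟨θ, rfl⟩
    exact Real.sqrt_le_sqrt <| by
      simpa using mul_le_mul_of_nonneg_left (Real.cos_le_one (2 * θ - φ)) hr

theorem iInf_sqrt_add_mul_cos {m r φ : ℝ} (hr : 0 ≤ r) :
    ⨅ θ : ℝ, √(m + r * Real.cos (2 * θ - φ)) = √(m - r) := by
  refine IsLeast.csInf_eq ⟨⟨φ / 2 + Real.pi / 2, ?_⟩, ?_⟩
  · have hangle : 2 * (φ / 2 + Real.pi / 2) - φ = Real.pi := by ring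
    simp only [hangle, Real.cos_pi, mul_neg, mul_one, sub_eq_add_neg]
  · rintro _ ⟨θ, rfl⟩
    refine Real.sqrt_le_sqrt ?_
    linarith [mul_le_mul_of_nonneg_left (Real.neg_one_le_cos (2 * θ - φ)) hr]

theorem iSup_mul_iInf_sqrt_cos_sin_form {A B : ℝ} (C : ℝ) (h : 0 ≤ A + B) :
    (⨆ θ, √(A * Real.cos θ ^ 2 + 2 * C * (Real.sin θ * Real.cos θ) + B * Real.sin θ ^ 2))
      * (⨅ θ, √(A * Real.cos θ ^ 2 + 2 * C * (Real.sin θ * Real.cos θ) + B * Real.sin θ ^ 2))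
      = √(A * B - C ^ 2) := by
  obtain ⟨r, φ, hr, hrsq, hform⟩ := exists_cos_sin_form_eq A B C
  simp only [hform]
  rw [iSup_sqrt_add_mul_cos hr, iInf_sqrt_add_mul_cos hr, ← Real.sqrt_mul (by positivity)]
  congr 1
  linear_combination -hrsq

end QuadraticForm

section WeightedInner

variable {ι : Type*}

/-- The weighted scalar product `∑ w(i) u(i) v(i)` over a finite set, which for suitable weights
polarizes `‖·‖_ℓ²`. -/
def weightedInner (s : Finset ι) (w u v : ι → ℝ) : ℝ := ∑ i ∈ s, w i * (u i * v i)

/-- The Gram determinant of two functions for a weighted scalar product. Its root is the product of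
the maximum and the minimum of the norm of `sin θ • v + cos θ • u` over `θ`. -/
def gramDet (s : Finset ι) (w u v : ι → ℝ) : ℝ :=
  weightedInner s w u u * weightedInner s w v v - weightedInner s w u v ^ 2

variable {s : Finset ι} {w : ι → ℝ} (u v : ι → ℝ)

theorem weightedInner_self_nonneg (hw : ∀ i ∈ s, 0 ≤ w i) : 0 ≤ weightedInner s w u u :=
  Finset.sum_nonneg fun i hi => mul_nonneg (hw i hi) (mul_self_nonneg _)

theorem sum_sum_sq_eq_two_mul_gramDet (s : Finset ι) (w u v : ι → ℝ) :
    ∑ i ∈ s, ∑ j ∈ s, w i * (w j * (u i * v j - v i * u j) ^ 2) = 2 * gramDet s w u v := by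
  have hexpand : ∀ i j, w i * (w j * (u i * v j - v i * u j) ^ 2)
      = w i * (u i * u i) * (w j * (v j * v j)) + w i * (v i * v i) * (w j * (u j * u j))
        - 2 * (w i * (u i * v i) * (w j * (u j * v j))) := fun i j => by ring
  simp only [hexpand, Finset.sum_add_distrib, Finset.sum_sub_distrib, ← Finset.mul_sum,
    ← Finset.sum_mul]
  rw [gramDet, weightedInner, weightedInner, weightedInner]
  ring

theorem gramDet_nonneg (hw : ∀ i ∈ s, 0 ≤ w i) : 0 ≤ gramDet s w u v := by
  have hsum : 0 ≤ ∑ i ∈ s, ∑ j ∈ s, w i * (w j * (u i * v j - v i * u j) ^ 2) :=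
    Finset.sum_nonneg fun i hi => Finset.sum_nonneg fun j hj =>
      mul_nonneg (hw i hi) (mul_nonneg (hw j hj) (sq_nonneg _))
  rw [sum_sum_sq_eq_two_mul_gramDet] at hsum
  linarith

theorem sum_norm_sq_mul_sub (s : Finset ι) (w u v : ι → ℝ) (m : ℂ) :
    ∑ i ∈ s, w i * ‖m * u i - v i‖ ^ 2 = weightedInner s w v v
      - 2 * m.re * weightedInner s w u v + (m.re ^ 2 + m.im ^ 2) * weightedInner s w u u := by
  simp only [weightedInner, Finset.mul_sum, ← Finset.sum_add_distrib, ← Finset.sum_sub_distrib]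
  refine Finset.sum_congr rfl fun i _ => ?_
  rw [Complex.sq_norm, Complex.normSq_apply, Complex.sub_re, Complex.sub_im, Complex.re_mul_ofReal,
    Complex.im_mul_ofReal, Complex.ofReal_re, Complex.ofReal_im]
  ring

theorem two_mul_sqrt_gramDet_mul_im_le (hw : ∀ i ∈ s, 0 ≤ w i) (m : ℂ) :
    2 * √(gramDet s w u v) * m.im ≤ ∑ i ∈ s, w i * ‖m * u i - v i‖ ^ 2 := by
  have hsqrt := Real.sq_sqrt (gramDet_nonneg u v hw)
  have hu := weightedInner_self_nonneg u hw
  rcases hu.eq_or_lt with hzero | hpos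
  · have hdet : √(gramDet s w u v) = 0 := Real.sqrt_eq_zero_of_nonpos <| by
      rw [gramDet, ← hzero, zero_mul, zero_sub]
      exact neg_nonpos.2 (sq_nonneg _)
    rw [hdet, mul_zero, zero_mul]
    exact Finset.sum_nonneg fun i hi => mul_nonneg (hw i hi) (sq_nonneg _)
  · rw [sum_norm_sq_mul_sub]
    refine le_of_mul_le_mul_left ?_ hpos
    rw [gramDet] at hsqrt ⊢
    linarith [sq_nonneg (weightedInner s w u v - m.re * weightedInner s w u u),
      sq_nonneg (√(weightedInner s w u u * weightedInner s w v v - weightedInner s w u v ^ 2)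
        - m.im * weightedInner s w u u)]

end WeightedInner

section Volterra

variable {N : ℕ} {w : ℕ → ℝ}

theorem norm_sq_sum_Ico_le (hw : ∀ k ∈ Finset.Icc 1 N, 0 ≤ w k)
    (hw_one : ∀ k ∈ Finset.Ico 1 N, w k = 1) {n : ℕ} (hn : n ≤ N) (κ : ℕ → ℝ) (G : ℕ → ℂ) :
    ‖∑ k ∈ Finset.Ico 1 n, (κ k : ℂ) * G k‖ ^ 2
      ≤ (∑ k ∈ Finset.Icc 1 N, w k * κ k ^ 2) * ∑ k ∈ Finset.Icc 1 N, w k * ‖G k‖ ^ 2 := by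
  have hle : ∀ f : ℕ → ℝ, (∀ k, 0 ≤ f k) →
      ∑ k ∈ Finset.Ico 1 n, f k ≤ ∑ k ∈ Finset.Icc 1 N, w k * f k := fun f hf => by
    have hsub := Finset.Ico_subset_Ico_right (a := 1) hn
    rw [Finset.sum_congr rfl fun k hk => show f k = w k * f k by rw [hw_one k (hsub hk), one_mul]]
    exact Finset.sum_le_sum_of_subset_of_nonneg (hsub.trans Finset.Ico_subset_Icc_self)
      fun k hk _ => mul_nonneg (hw k hk) (hf k)
  calc ‖∑ k ∈ Finset.Ico 1 n, (κ k : ℂ) * G k‖ ^ 2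
      ≤ (∑ k ∈ Finset.Ico 1 n, ‖(κ k : ℂ)‖ * ‖G k‖) ^ 2 := by
        gcongr
        exact norm_sum_le_of_le _ fun k _ => norm_mul_le _ _
    _ ≤ (∑ k ∈ Finset.Ico 1 n, ‖(κ k : ℂ)‖ ^ 2) * ∑ k ∈ Finset.Ico 1 n, ‖G k‖ ^ 2 :=
        Finset.sum_mul_sq_le_sq_mul_sq _ _ _
    _ ≤ (∑ k ∈ Finset.Icc 1 N, w k * ‖(κ k : ℂ)‖ ^ 2) * ∑ k ∈ Finset.Icc 1 N, w k * ‖G k‖ ^ 2 := by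
        gcongr
        · exact Finset.sum_nonneg fun k hk => mul_nonneg (hw k hk) (sq_nonneg _)
        · exact hle _ fun k => sq_nonneg _
        · exact hle _ fun k => sq_nonneg _
    _ = _ := by simp only [Complex.norm_real, Real.norm_eq_abs, sq_abs]

theorem sum_norm_sq_sum_Ico_le (hw : ∀ k ∈ Finset.Icc 1 N, 0 ≤ w k)
    (hw_one : ∀ k ∈ Finset.Ico 1 N, w k = 1) (u v : ℕ → ℝ) (G : ℕ → ℂ) :
    ∑ n ∈ Finset.Icc 1 N,
        w n * ‖∑ k ∈ Finset.Ico 1 n, ((u n * v k - v n * u k : ℝ) : ℂ) * G k‖ ^ 2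
      ≤ 2 * gramDet (Finset.Icc 1 N) w u v * ∑ n ∈ Finset.Icc 1 N, w n * ‖G n‖ ^ 2 := by
  rw [← sum_sum_sq_eq_two_mul_gramDet, Finset.sum_mul]
  refine Finset.sum_le_sum fun n hn => ?_
  rw [← Finset.mul_sum, mul_assoc]
  exact mul_le_mul_of_nonneg_left
    (norm_sq_sum_Ico_le hw hw_one (Finset.mem_Icc.1 hn).2 _ G) (hw n hn)

end Volterra

section TruncatedNorm

/-- The weights of the sites `1, …, ⌊ℓ⌋ + 1` in the truncated norm `‖u‖_ℓ`. -/
def truncWeight (ℓ : ℝ) (n : ℕ) : ℝ := if n ≤ ⌊ℓ⌋₊ then 1 else ℓ - ⌊ℓ⌋₊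

theorem truncWeight_nonneg {ℓ : ℝ} (hℓ : 0 ≤ ℓ) (n : ℕ) : 0 ≤ truncWeight ℓ n := by
  unfold truncWeight
  split_ifs
  · exact zero_le_one
  · exact sub_nonneg.2 (Nat.floor_le hℓ)

theorem truncWeight_le_one (ℓ : ℝ) (n : ℕ) : truncWeight ℓ n ≤ 1 := by
  unfold truncWeight
  split_ifs
  · exact le_rfl
  · linarith [Nat.lt_floor_add_one ℓ]

theorem truncNorm_eq_sqrt_weightedInner (ℓ : ℝ) (u : ℕ → ℝ) :
    truncNorm ℓ u = √(weightedInner (Finset.Icc 1 (⌊ℓ⌋₊ + 1)) (truncWeight ℓ) u u) := by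
  rw [truncNorm, weightedInner, Finset.sum_Icc_succ_top (Nat.le_add_left 1 _), truncWeight,
    if_neg (Nat.not_succ_le_self _), sq_abs, sq]
  congr 2
  refine Finset.sum_congr rfl fun n hn => ?_
  rw [truncWeight, if_pos (Finset.mem_Icc.1 hn).2, sq_abs, sq, one_mul]

end TruncatedNorm

section Solutions

variable {a b : ℕ → ℝ} {E : ℝ}

theorem jacobiSolution_eq_sin_mul_add_cos_mul (a b : ℕ → ℝ) (E θ : ℝ) (n : ℕ) :
    jacobiSolution a b E θ n = Real.sin θ * jacobiSolution a b E (Real.pi / 2) n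
      + Real.cos θ * jacobiSolution a b E 0 n := by
  induction n using Nat.twoStepInduction with
  | zero => simp [jacobiSolution]
  | one => simp [jacobiSolution]
  | more n ih ih_succ =>
    simp only [jacobiSolution]
    rw [ih, ih_succ]
    ring

theorem iSup_mul_iInf_truncNorm (a b : ℕ → ℝ) (E : ℝ) {ℓ : ℝ} (hℓ : 0 ≤ ℓ) :
    (⨆ θ : ℝ, truncNorm ℓ (jacobiSolution a b E θ)) *
      (⨅ θ : ℝ, truncNorm ℓ (jacobiSolution a b E θ))
      = √(gramDet (Finset.Icc 1 (⌊ℓ⌋₊ + 1)) (truncWeight ℓ) (jacobiSolution a b E 0)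
          (jacobiSolution a b E (Real.pi / 2))) := by
  set s := Finset.Icc 1 (⌊ℓ⌋₊ + 1)
  set u := jacobiSolution a b E 0
  set v := jacobiSolution a b E (Real.pi / 2)
  have hform : ∀ θ, truncNorm ℓ (jacobiSolution a b E θ)
      = √(weightedInner s (truncWeight ℓ) u u * Real.cos θ ^ 2
        + 2 * weightedInner s (truncWeight ℓ) u v * (Real.sin θ * Real.cos θ)
        + weightedInner s (truncWeight ℓ) v v * Real.sin θ ^ 2) := fun θ => by
    rw [truncNorm_eq_sqrt_weightedInner]
    congr 1
    simp only [weightedInner, Finset.mul_sum, Finset.sum_mul, ← Finset.sum_add_distrib]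
    refine Finset.sum_congr rfl fun n _ => ?_
    rw [jacobiSolution_eq_sin_mul_add_cos_mul]
    ring
  have hw : ∀ n ∈ s, 0 ≤ truncWeight ℓ n := fun n _ => truncWeight_nonneg hℓ n
  simp only [hform]
  exact iSup_mul_iInf_sqrt_cos_sin_form _
    (add_nonneg (weightedInner_self_nonneg u hw) (weightedInner_self_nonneg v hw))

theorem jacobiSolution_recurrence (ha : ∀ n, a (n + 1) ≠ 0) (θ : ℝ) (n : ℕ) :
    a (n + 1) * jacobiSolution a b E θ (n + 2) = (E - b (n + 1)) * jacobiSolution a b E θ (n + 1)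
      - a n * jacobiSolution a b E θ n := by
  rw [jacobiSolution, mul_div_cancel₀ _ (ha n)]

/-- The kernel of the variation of parameters formula: `n ↦ jacobiKernel a b E n k` solves the
recurrence and vanishes at `n = k`. -/
def jacobiKernel (a b : ℕ → ℝ) (E : ℝ) (n k : ℕ) : ℝ :=
  jacobiSolution a b E 0 n * jacobiSolution a b E (Real.pi / 2) k
    - jacobiSolution a b E (Real.pi / 2) n * jacobiSolution a b E 0 k

theorem jacobiKernel_self (a b : ℕ → ℝ) (E : ℝ) (n : ℕ) : jacobiKernel a b E n n = 0 := by
  rw [jacobiKernel, mul_comm, sub_self]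

theorem jacobiKernel_recurrence (ha : ∀ n, a (n + 1) ≠ 0) (n k : ℕ) :
    a (n + 1) * jacobiKernel a b E (n + 2) k
      = (E - b (n + 1)) * jacobiKernel a b E (n + 1) k - a n * jacobiKernel a b E n k := by
  simp only [jacobiKernel]
  linear_combination
    jacobiSolution a b E (Real.pi / 2) k * jacobiSolution_recurrence (b := b) (E := E) ha 0 n
    - jacobiSolution a b E 0 k * jacobiSolution_recurrence (b := b) (E := E) ha (Real.pi / 2) n

/-- The left side is the Wronskian of `u_0` and `u_{π/2}`. -/
theorem mul_jacobiKernel_succ_self (ha : ∀ n, a (n + 1) ≠ 0) (n : ℕ) :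
    a n * jacobiKernel a b E (n + 1) n = a 0 := by
  induction n with
  | zero => simp [jacobiKernel, jacobiSolution]
  | succ n ih =>
    rw [jacobiKernel_recurrence ha, jacobiKernel_self, mul_zero, zero_sub, ← ih]
    simp only [jacobiKernel]
    ring

theorem sum_Ico_jacobiKernel_recurrence (ha : ∀ n, a (n + 1) ≠ 0) (G : ℕ → ℂ) (n : ℕ) :
    a (n + 1) * ∑ k ∈ Finset.Ico 1 (n + 2), (jacobiKernel a b E (n + 2) k : ℂ) * G k
      = (E - b (n + 1)) * ∑ k ∈ Finset.Ico 1 (n + 1), (jacobiKernel a b E (n + 1) k : ℂ) * G k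
        - a n * ∑ k ∈ Finset.Ico 1 n, (jacobiKernel a b E n k : ℂ) * G k + a 0 * G (n + 1) := by
  have hrec : ∀ k, (a (n + 1) : ℂ) * jacobiKernel a b E (n + 2) k
      = (E - b (n + 1)) * jacobiKernel a b E (n + 1) k - a n * jacobiKernel a b E n k :=
    fun k => by exact_mod_cast jacobiKernel_recurrence (b := b) (E := E) ha n k
  have hwronskian : (a (n + 1) : ℂ) * jacobiKernel a b E (n + 2) (n + 1) = a 0 := by
    exact_mod_cast mul_jacobiKernel_succ_self (b := b) (E := E) ha (n + 1)
  have hlast : ∑ k ∈ Finset.Ico 1 n, (jacobiKernel a b E n k : ℂ) * G k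
      = ∑ k ∈ Finset.Ico 1 (n + 1), (jacobiKernel a b E n k : ℂ) * G k := by
    rcases n.eq_zero_or_pos with rfl | hn
    · rfl
    · rw [Finset.sum_Ico_succ_top hn, jacobiKernel_self, Complex.ofReal_zero, zero_mul, add_zero]
  rw [hlast, Finset.sum_Ico_succ_top (Nat.le_add_left 1 n), mul_add, ← mul_assoc, hwronskian]
  simp only [Finset.mul_sum, ← mul_assoc, hrec, sub_mul, Finset.sum_sub_distrib]

theorem variation_of_parameters (ha : ∀ n, a (n + 1) ≠ 0) {z : ℂ} {G : ℕ → ℂ}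
    (hG : ∀ n, a (n + 1) * G (n + 2) + a n * G n + b (n + 1) * G (n + 1) = z * G (n + 1)) (n : ℕ) :
    a 0 * G n
      = a 0 * (G 0 * jacobiSolution a b E (Real.pi / 2) n + G 1 * jacobiSolution a b E 0 n)
        + (z - E) * ∑ k ∈ Finset.Ico 1 n, (jacobiKernel a b E n k : ℂ) * G k := by
  have hrec : ∀ θ n, (a (n + 1) : ℂ) * jacobiSolution a b E θ (n + 2)
      = (E - b (n + 1)) * jacobiSolution a b E θ (n + 1) - a n * jacobiSolution a b E θ n :=
    fun θ n => by exact_mod_cast jacobiSolution_recurrence (b := b) (E := E) ha θ n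
  induction n using Nat.twoStepInduction with
  | zero => simp [jacobiSolution]
  | one => simp [jacobiSolution]
  | more n ih ih_succ =>
    refine mul_left_cancel₀ (Complex.ofReal_ne_zero.2 (ha n)) ?_
    linear_combination a 0 * hG n + (E - b (n + 1)) * ih_succ - a n * ih
      - a 0 * G 0 * hrec (Real.pi / 2) n - a 0 * G 1 * hrec 0 n
      - (z - E) * sum_Ico_jacobiKernel_recurrence (b := b) (E := E) ha G n

theorem norm_sub_mul_sq_le (x c y : ℂ) : ‖x - c * y‖ ^ 2 ≤ 2 * ‖x‖ ^ 2 + 2 * ‖c‖ ^ 2 * ‖y‖ ^ 2 :=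
  calc ‖x - c * y‖ ^ 2 ≤ (‖x‖ + ‖c * y‖) ^ 2 := by gcongr; exact norm_sub_le _ _
    _ ≤ 2 * (‖x‖ ^ 2 + ‖c * y‖ ^ 2) := add_sq_le
    _ = 2 * ‖x‖ ^ 2 + 2 * ‖c‖ ^ 2 * ‖y‖ ^ 2 := by rw [norm_mul]; ring

theorem iSup_mul_iInf_truncNorm_mul_im_le (ha : ∀ n, a (n + 1) ≠ 0) (ha_zero : a 0 = 1) {z : ℂ}
    {G : ℕ → ℂ}
    (hG : ∀ n, a (n + 1) * G (n + 2) + a n * G n + b (n + 1) * G (n + 1) = z * G (n + 1))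
    (hG_zero : G 0 = -1) {ℓ P : ℝ} (hℓ : 0 ≤ ℓ)
    (hP : (⨆ θ : ℝ, truncNorm ℓ (jacobiSolution a b E θ)) *
      (⨅ θ : ℝ, truncNorm ℓ (jacobiSolution a b E θ)) = P) :
    P * (G 1).im ≤ (1 + 2 * ‖z - E‖ ^ 2 * P ^ 2)
      * ∑ n ∈ Finset.Icc 1 (⌊ℓ⌋₊ + 1), truncWeight ℓ n * ‖G n‖ ^ 2 := by
  rw [iSup_mul_iInf_truncNorm a b E hℓ] at hP
  set s := Finset.Icc 1 (⌊ℓ⌋₊ + 1)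
  set u := jacobiSolution a b E 0
  set v := jacobiSolution a b E (Real.pi / 2)
  set K : ℕ → ℂ := fun n => ∑ k ∈ Finset.Ico 1 n, (jacobiKernel a b E n k : ℂ) * G k
  have hw : ∀ n ∈ s, 0 ≤ truncWeight ℓ n := fun n _ => truncWeight_nonneg hℓ n
  have hw_one : ∀ n ∈ Finset.Ico 1 (⌊ℓ⌋₊ + 1), truncWeight ℓ n = 1 := fun n hn =>
    if_pos (Nat.lt_succ_iff.1 (Finset.mem_Ico.1 hn).2)
  have hdet : gramDet s (truncWeight ℓ) u v = P ^ 2 := by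
    rw [← hP, Real.sq_sqrt (gramDet_nonneg u v hw)]
  have hK : ∑ n ∈ s, truncWeight ℓ n * ‖K n‖ ^ 2
      ≤ 2 * P ^ 2 * ∑ n ∈ s, truncWeight ℓ n * ‖G n‖ ^ 2 :=
    hdet ▸ sum_norm_sq_sum_Ico_le hw hw_one u v G
  have hweyl : ∀ n, G 1 * u n - v n = G n - (z - E) * K n := fun n => by
    have h := variation_of_parameters (E := E) ha hG n
    rw [hG_zero, ha_zero, Complex.ofReal_one] at h
    linear_combination -h
  have hsum : 2 * P * (G 1).im ≤ 2 * ∑ n ∈ s, truncWeight ℓ n * ‖G n‖ ^ 2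
      + 2 * ‖z - E‖ ^ 2 * ∑ n ∈ s, truncWeight ℓ n * ‖K n‖ ^ 2 := by
    rw [← hP]
    refine (two_mul_sqrt_gramDet_mul_im_le u v hw (G 1)).trans ?_
    rw [Finset.mul_sum, Finset.mul_sum, ← Finset.sum_add_distrib]
    refine Finset.sum_le_sum fun n hn => ?_
    rw [hweyl]
    linarith [mul_le_mul_of_nonneg_left (norm_sub_mul_sq_le (G n) (z - E) (K n)) (hw n hn)]
  have hmul := mul_le_mul_of_nonneg_left hK (sq_nonneg ‖z - E‖)
  linarith

end Solutions

/-! ### The Green function as the Laplace transform of the wavepacket -/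

section GreenFunction

variable {d : ℕ} (V : (Fin d → ℤ) → ℝ)

instance isFiniteMeasure_spectralMeasure (ψ : (hamiltonian V).domain) :
    IsFiniteMeasure (spectralMeasure V ψ) := (spectralMeasure_spec V ψ).1

theorem matrixElement_inv_sub {z : ℂ} (hz : z.im ≠ 0) (φ : (hamiltonian V).domain)
    {ψ g : (hamiltonian V).domain} (hg : hamiltonian V g - z • (g : L2 d) = ψ) :
    matrixElement V (fun x => ((x : ℂ) - z)⁻¹) φ ψ = inner ℂ (φ : L2 d) (g : L2 d) := by
  obtain ⟨p, hp⟩ := exists_resolvent (isSelfAdjoint_hamiltonian V) hz (φ : L2 d)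
  have h_inner (k : ℕ) : ∫ x, ((x : ℂ) - z)⁻¹ ∂spectralMeasure V (φ + Complex.I ^ k • ψ)
      = inner ℂ ((φ : L2 d) + Complex.I ^ k • (ψ : L2 d))
          ((p : L2 d) + Complex.I ^ k • (g : L2 d)) := by
    refine ((spectralMeasure_spec V (φ + Complex.I ^ k • ψ)).2 z hz
      (p + Complex.I ^ k • g) ?_).symm
    rw [LinearPMap.map_add, LinearPMap.map_smul, Submodule.coe_add, Submodule.coe_smul,
      Submodule.coe_add, Submodule.coe_smul, ← hp, ← hg]
    module
  simp only [matrixElement, h_inner, sum_polarization]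

theorem matrixElement_exp_eq_sum_charFun (φ ψ : (hamiltonian V).domain) (t : ℝ) :
    matrixElement V (fun x => Complex.exp (-Complex.I * x * t)) φ ψ
      = (1 / 4) * ∑ k ∈ Finset.range 4, (-Complex.I) ^ k *
          charFun (spectralMeasure V (φ + Complex.I ^ k • ψ)) (-t) := by
  simp only [matrixElement, charFun_apply_real]
  congr! 6
  push_cast
  ring

theorem measurable_wavepacket (n : Fin d → ℤ) : Measurable fun t => wavepacket V t n := by
  simp only [wavepacket, matrixElement_exp_eq_sum_charFun]
  fun_prop

theorem exists_norm_wavepacket_le (n : Fin d → ℤ) : ∃ M : ℝ, ∀ t, ‖wavepacket V t n‖ ≤ M := by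
  refine ⟨‖(1 / 4 : ℂ)‖ * ∑ k ∈ Finset.range 4, ‖(-Complex.I) ^ k‖ *
    (spectralMeasure V (delta V n + Complex.I ^ k • delta V 0)).real Set.univ, fun t => ?_⟩
  rw [wavepacket, matrixElement_exp_eq_sum_charFun, norm_mul]
  gcongr
  refine norm_sum_le_of_le _ fun k _ => ?_
  rw [norm_mul]
  gcongr
  exact norm_charFun_le _

theorem integrableOn_exp_mul_norm_sq_wavepacket {ε : ℝ} (hε : 0 < ε) (n : Fin d → ℤ) :
    IntegrableOn (fun t => Real.exp (-2 * ε * t) * ‖wavepacket V t n‖ ^ 2) (Set.Ioi 0) := by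
  obtain ⟨M, hM⟩ := exists_norm_wavepacket_le V n
  refine (integrableOn_exp_mul_Ioi (by linarith) 0).mul_bdd (c := M ^ 2)
    ((measurable_wavepacket V n).norm.pow_const 2).aestronglyMeasurable
    (Eventually.of_forall fun t => ?_)
  rw [norm_pow, norm_norm]
  gcongr
  exact hM t

/-- The Green function `⟨δ_n, (H - z)⁻¹ δ_0⟩`, through the spectral measures of `H` as for
`Lattice.wavepacket`. -/
def greenFunction (z : ℂ) (n : Fin d → ℤ) : ℂ :=
  matrixElement V (fun x => ((x : ℂ) - z)⁻¹) (delta V n) (delta V 0)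

theorem greenFunction_eq {z : ℂ} (hz : z.im ≠ 0) {g : (hamiltonian V).domain}
    (hg : hamiltonian V g - z • (g : L2 d) = delta V 0) : greenFunction V z = (g : L2 d) :=
  funext fun n => (matrixElement_inv_sub V hz (delta V n) hg).trans (inner_delta V n g)

theorem fourierLaplace_wavepacket {z : ℂ} (hz : 0 < z.im) (n : Fin d → ℤ) :
    fourierLaplace (fun t => wavepacket V t n) z = -Complex.I * greenFunction V z n := by
  let μ (k : ℕ) := spectralMeasure V (delta V n + Complex.I ^ k • delta V 0)
  have h_integrable (k : ℕ) : IntegrableOn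
      (fun t : ℝ => Complex.exp (Complex.I * z * t) * charFun (μ k) (-t)) (Set.Ioi 0) :=
    integrableOn_exp_mul_of_bounded (by fun_prop) (fun t => norm_charFun_le _) hz
  calc fourierLaplace (fun t => wavepacket V t n) z
      = ∫ t in Set.Ioi (0 : ℝ), (1 / 4) * ∑ k ∈ Finset.range 4, (-Complex.I) ^ k *
          (Complex.exp (Complex.I * z * t) * charFun (μ k) (-t)) := by
        simp only [fourierLaplace, wavepacket, matrixElement_exp_eq_sum_charFun,
          mul_left_comm (Complex.exp _), Finset.mul_sum, μ]
    _ = (1 / 4) * ∑ k ∈ Finset.range 4, (-Complex.I) ^ k *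
          fourierLaplace (fun t => charFun (μ k) (-t)) z := by
        rw [integral_const_mul, integral_finsetSum _ fun k _ => (h_integrable k).const_mul _]
        simp only [integral_const_mul, fourierLaplace]
    _ = -Complex.I * greenFunction V z n := by
        simp only [fourierLaplace_charFun_neg _ hz, greenFunction, matrixElement, μ,
          mul_left_comm _ (-Complex.I), ← Finset.mul_sum]

theorem norm_sq_fourierLaplace_wavepacket {ε : ℝ} (hε : 0 < ε) (E : ℝ) (n : Fin d → ℤ) :
    ‖fourierLaplace (fun t => wavepacket V t n) ⟨E, ε⟩‖ ^ 2
      = ‖greenFunction V ⟨E, ε⟩ n‖ ^ 2 := by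
  rw [fourierLaplace_wavepacket V (z := ⟨E, ε⟩) hε, norm_mul, norm_neg, Complex.norm_I, one_mul]

theorem integrable_norm_sq_greenFunction {ε : ℝ} (hε : 0 < ε) (n : Fin d → ℤ) :
    Integrable fun E : ℝ => ‖greenFunction V ⟨E, ε⟩ n‖ ^ 2 := by
  obtain ⟨M, hM⟩ := exists_norm_wavepacket_le V n
  simpa only [norm_sq_fourierLaplace_wavepacket V hε] using
    integrable_norm_sq_fourierLaplace (measurable_wavepacket V n).aestronglyMeasurable hM hε

theorem integral_norm_sq_greenFunction {ε : ℝ} (hε : 0 < ε) (n : Fin d → ℤ) :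
    ∫ E : ℝ, ‖greenFunction V ⟨E, ε⟩ n‖ ^ 2
      = 2 * Real.pi * ∫ t in Set.Ioi 0, Real.exp (-2 * ε * t) * ‖wavepacket V t n‖ ^ 2 := by
  obtain ⟨M, hM⟩ := exists_norm_wavepacket_le V n
  simpa only [norm_sq_fourierLaplace_wavepacket V hε] using
    integral_norm_sq_fourierLaplace (measurable_wavepacket V n).aestronglyMeasurable hM hε

theorem integrable_ballWeight_greenFunction {ε : ℝ} (hε : 0 < ε) (R : ℝ) :
    Integrable fun E : ℝ => ballWeight R (greenFunction V ⟨E, ε⟩) :=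
  integrable_finsetSum _ fun n _ => integrable_norm_sq_greenFunction V hε n

end GreenFunction

/-! ### Poisson averaging of the spectral measure -/

section Poisson

open scoped ENNReal

theorem im_inv_ofReal_sub (x E ε : ℝ) :
    (((x : ℂ) - ⟨E, ε⟩)⁻¹).im = ε / ((x - E) ^ 2 + ε ^ 2) := by
  rw [Complex.inv_im, Complex.normSq_apply]
  simp only [Complex.sub_re, Complex.sub_im, Complex.ofReal_re, Complex.ofReal_im]
  congr 1 <;> ring

theorem integrable_inv_ofReal_sub (μ : Measure ℝ) [IsFiniteMeasure μ] {z : ℂ} (hz : z.im ≠ 0) :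
    Integrable (fun x : ℝ => ((x : ℂ) - z)⁻¹) μ := by
  refine (integrable_const |z.im|⁻¹).mono' (by fun_prop) (Eventually.of_forall fun x => ?_)
  rw [norm_inv]
  refine inv_anti₀ (abs_pos.2 hz) ?_
  simpa using Complex.abs_im_le_norm ((x : ℂ) - z)

theorem ofReal_im_integral_inv_sub (μ : Measure ℝ) [IsFiniteMeasure μ] {ε : ℝ} (hε : 0 < ε)
    (E : ℝ) : ENNReal.ofReal (∫ x, ((x : ℂ) - ⟨E, ε⟩)⁻¹ ∂μ).im
      = ∫⁻ x, ENNReal.ofReal (ε / ((x - E) ^ 2 + ε ^ 2)) ∂μ := by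
  have h_integrable := integrable_inv_ofReal_sub μ (z := ⟨E, ε⟩) hε.ne'
  have h_integrable_im : Integrable (fun x : ℝ => ε / ((x - E) ^ 2 + ε ^ 2)) μ := by
    simpa only [RCLike.im_to_complex, im_inv_ofReal_sub] using h_integrable.im
  rw [← ofReal_integral_eq_lintegral_ofReal h_integrable_im
    (Eventually.of_forall fun x => by dsimp only [Pi.zero_apply]; positivity)]
  congr 1
  simpa only [RCLike.im_to_complex, im_inv_ofReal_sub] using (integral_im h_integrable).symm

theorem one_le_setLIntegral_ball_poisson {ε : ℝ} (hε : 0 < ε) (x : ℝ) :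
    1 ≤ ∫⁻ E in Metric.ball x ε, ENNReal.ofReal (ε / ((x - E) ^ 2 + ε ^ 2)) :=
  calc (1 : ℝ≥0∞) = ∫⁻ _ in Metric.ball x ε, ENNReal.ofReal (1 / (2 * ε)) := by
        rw [setLIntegral_const, Real.volume_ball, ← ENNReal.ofReal_mul (by positivity),
          one_div_mul_cancel (by positivity), ENNReal.ofReal_one]
    _ ≤ ∫⁻ E in Metric.ball x ε, ENNReal.ofReal (ε / ((x - E) ^ 2 + ε ^ 2)) := by
        refine setLIntegral_mono (by fun_prop) fun E hE => ENNReal.ofReal_le_ofReal ?_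
        rw [Metric.mem_ball', Real.dist_eq] at hE
        have h_sq : (x - E) ^ 2 < ε ^ 2 := sq_lt_sq.2 (hE.trans_le (le_abs_self ε))
        rw [div_le_div_iff₀ (by positivity) (by positivity)]
        nlinarith

theorem measure_le_setLIntegral_thickening_poisson (μ : Measure ℝ) [IsFiniteMeasure μ] {ε : ℝ}
    (hε : 0 < ε) (S : Set ℝ) :
    μ S ≤ ∫⁻ E in Metric.thickening ε S, ENNReal.ofReal (∫ x, ((x : ℂ) - ⟨E, ε⟩)⁻¹ ∂μ).im := by
  let k (x E : ℝ) : ℝ≥0∞ := ENNReal.ofReal (ε / ((x - E) ^ 2 + ε ^ 2))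
  have hk : Measurable (Function.uncurry k) := by fun_prop
  let ν := volume.restrict (Metric.thickening ε S)
  calc μ S ≤ μ {x | 1 ≤ ∫⁻ E, k x E ∂ν} :=
        measure_mono fun x hx => (one_le_setLIntegral_ball_poisson hε x).trans
          (lintegral_mono_set (Metric.ball_subset_thickening hx ε))
    _ ≤ ∫⁻ x, ∫⁻ E, k x E ∂ν ∂μ := by
        simpa only [one_mul] using mul_meas_ge_le_lintegral hk.lintegral_prod_right 1
    _ = ∫⁻ E, ∫⁻ x, k x E ∂μ ∂ν := lintegral_lintegral_swap hk.aemeasurable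
    _ = _ := by simp only [ofReal_im_integral_inv_sub μ hε, k, ν]

end Poisson

/-! ### The dynamical bound -/

section DynamicalBound

variable {d : ℕ} (V : (Fin d → ℤ) → ℝ)

theorem timeAverage_ballWeight_eq_integral_greenFunction {T : ℝ} (hT : 0 < T) (R : ℝ) :
    timeAverage T (fun t => ballWeight R (wavepacket V t))
      = T⁻¹ / Real.pi * ∫ E : ℝ, ballWeight R (greenFunction V ⟨E, T⁻¹⟩) := by
  have hε : 0 < T⁻¹ := inv_pos.2 hT
  have h_exp (t : ℝ) : Real.exp (-2 * t / T) = Real.exp (-2 * T⁻¹ * t) := by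
    congr 1
    ring
  simp only [timeAverage, ballWeight, Finset.mul_sum, h_exp]
  rw [integral_finsetSum _ fun n _ => integrableOn_exp_mul_norm_sq_wavepacket V hε n,
    integral_finsetSum _ fun n _ => integrable_norm_sq_greenFunction V hε n]
  simp only [integral_norm_sq_greenFunction V hε, Finset.mul_sum]
  refine Finset.sum_congr rfl fun n _ => ?_
  field_simp

theorem timeAverage_ballWeight_pos {T R : ℝ} (hT : 0 < T) (hR : 1 < R) :
    0 < timeAverage T (fun t => ballWeight R (wavepacket V t)) := by
  have hε : 0 < T⁻¹ := inv_pos.2 hT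
  have h_pos (E : ℝ) : 0 < ballWeight R (greenFunction V ⟨E, T⁻¹⟩) := by
    obtain ⟨g, hg⟩ := exists_resolvent (isSelfAdjoint_hamiltonian V) (z := ⟨E, T⁻¹⟩) hε.ne'
      (delta V 0 : L2 d)
    rw [greenFunction_eq V hε.ne' hg]
    exact ballWeight_pos V hg hR
  rw [timeAverage_ballWeight_eq_integral_greenFunction V hT]
  refine mul_pos (by positivity) ((integral_pos_iff_support_of_nonneg (fun E => (h_pos E).le)
    (integrable_ballWeight_greenFunction V hε R)).2 ?_)
  simp [Function.support_eq_univ fun E => (h_pos E).ne']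

theorem exists_floor_lt_of_lengthScale_le {a b : ℕ → ℝ} {ε E L : ℝ} (hL : 0 ≤ L)
    (hE : lengthScale a b ε E ≤ ENNReal.ofReal L) : ∃ ℓ : ℝ, 0 ≤ ℓ ∧ (⌊ℓ⌋₊ : ℝ) < L + 1 ∧
      (⨆ θ : ℝ, truncNorm ℓ (jacobiSolution a b E θ)) *
        (⨅ θ : ℝ, truncNorm ℓ (jacobiSolution a b E θ)) = ε⁻¹ := by
  have h_lt : lengthScale a b ε E < ENNReal.ofReal (⌊L⌋₊ + 1) :=
    hE.trans_lt ((ENNReal.ofReal_lt_ofReal_iff (by positivity)).2 (Nat.lt_floor_add_one L))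
  obtain ⟨_, ⟨ℓ, hℓ, rfl, hscale⟩, hℓL⟩ := sInf_lt_iff.1 h_lt
  have hℓ_lt : ℓ < (⌊L⌋₊ + 1 : ℕ) := by
    exact_mod_cast (ENNReal.ofReal_lt_ofReal_iff (by positivity)).1 hℓL
  refine ⟨ℓ, hℓ, ?_, hscale⟩
  calc (⌊ℓ⌋₊ : ℝ) ≤ ⌊L⌋₊ := by exact_mod_cast Nat.lt_succ_iff.1 ((Nat.floor_lt hℓ).2 hℓ_lt)
    _ ≤ L := Nat.floor_le hL
    _ < L + 1 := lt_add_one L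

theorem sum_truncWeight_rhoCoeff_le (hd : 0 < d) (g : L2 d) {ℓ R : ℝ} (hℓ : (⌊ℓ⌋₊ : ℝ) < R) :
    ∑ n ∈ Finset.Icc 1 (⌊ℓ⌋₊ + 1), truncWeight ℓ n * ‖rhoCoeff V g n‖ ^ 2 ≤ ballWeight R g :=
  calc ∑ n ∈ Finset.Icc 1 (⌊ℓ⌋₊ + 1), truncWeight ℓ n * ‖rhoCoeff V g n‖ ^ 2
      ≤ ∑ n ∈ Finset.Icc 1 (⌊ℓ⌋₊ + 1), ‖rhoCoeff V g n‖ ^ 2 :=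
        Finset.sum_le_sum fun n _ => mul_le_of_le_one_left (sq_nonneg _) (truncWeight_le_one ℓ n)
    _ = ∑ n ∈ Finset.range (⌊ℓ⌋₊ + 1), ‖inner ℂ (rho V n) g‖ ^ 2 := by
        rw [Finset.range_eq_Ico]
        exact (Finset.sum_Ico_add' (fun n => ‖rhoCoeff V g n‖ ^ 2) 0 (⌊ℓ⌋₊ + 1) 1).symm
    _ ≤ ballWeight R g := sum_norm_sq_inner_rho_le V hd g fun k hk => lt_of_le_of_lt
        (by exact_mod_cast Finset.mem_range_succ_iff.1 hk) hℓ

theorem rhoCoeff_one {z : ℂ} (hz : z.im ≠ 0) {g : (hamiltonian V).domain}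
    (hg : hamiltonian V g - z • (g : L2 d) = delta V 0) :
    rhoCoeff V g 1 = ∫ x, ((x : ℂ) - z)⁻¹ ∂spectralMeasure V (delta V 0) := by
  rw [← (spectralMeasure_spec V (delta V 0)).2 z hz g hg, rhoCoeff, rho_zero]

theorem im_integral_inv_sub_le_ballWeight_greenFunction (hd : 0 < d) {ε L E E' : ℝ} (hε : 0 < ε)
    (hL : 0 ≤ L) (hE : lengthScale (polyA V) (polyB V) ε E ≤ ENNReal.ofReal L)
    (hEE' : |E' - E| < ε) :
    (∫ x, ((x : ℂ) - ⟨E', ε⟩)⁻¹ ∂spectralMeasure V (delta V 0)).im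
      ≤ 5 * ε * ballWeight (L + 1) (greenFunction V ⟨E', ε⟩) := by
  obtain ⟨g, hg⟩ := exists_resolvent (isSelfAdjoint_hamiltonian V) (z := ⟨E', ε⟩) hε.ne'
    (delta V 0 : L2 d)
  obtain ⟨ℓ, hℓ, hℓ_lt, hscale⟩ := exists_floor_lt_of_lengthScale_le hL hE
  have hz : ‖(⟨E', ε⟩ : ℂ) - E‖ ^ 2 ≤ 2 * ε ^ 2 := by
    rw [Complex.sq_norm, Complex.normSq_apply]
    simp only [Complex.sub_re, Complex.sub_im, Complex.ofReal_re, Complex.ofReal_im, sub_zero]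
    nlinarith [sq_lt_sq.2 (hEE'.trans_le (le_abs_self ε))]
  have h_const : 1 + 2 * ‖(⟨E', ε⟩ : ℂ) - E‖ ^ 2 * ε⁻¹ ^ 2 ≤ 5 :=
    calc 1 + 2 * ‖(⟨E', ε⟩ : ℂ) - E‖ ^ 2 * ε⁻¹ ^ 2 ≤ 1 + 2 * (2 * ε ^ 2) * ε⁻¹ ^ 2 := by gcongr
      _ = 5 := by field_simp; norm_num
  have h_jacobi := iSup_mul_iInf_truncNorm_mul_im_le (fun n => polyA_ne_zero V hd (n + 1)) rfl
    (rhoCoeff_recurrence V hd hg) rfl hℓ hscale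
  rw [greenFunction_eq V hε.ne' hg, ← rhoCoeff_one V hε.ne' hg]
  calc (rhoCoeff V g 1).im = ε * (ε⁻¹ * (rhoCoeff V g 1).im) := by field_simp
    _ ≤ ε * (5 * ballWeight (L + 1) (g : L2 d)) := by
        refine mul_le_mul_of_nonneg_left (h_jacobi.trans ?_) hε.le
        gcongr
        · exact Finset.sum_nonneg fun n _ => mul_nonneg (truncWeight_nonneg hℓ n) (sq_nonneg _)
        · exact sum_truncWeight_rhoCoeff_le V hd g hℓ_lt
    _ = 5 * ε * ballWeight (L + 1) (g : L2 d) := by ring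

theorem measureReal_lengthScale_le_timeAverage (hd : 0 < d) {T L : ℝ} (hT : 0 < T) (hL : 0 ≤ L) :
    (spectralMeasure V (delta V 0)).real
        {E : ℝ | lengthScale (polyA V) (polyB V) T⁻¹ E ≤ ENNReal.ofReal L}
      ≤ 5 * Real.pi * timeAverage T (fun t => ballWeight (L + 1) (wavepacket V t)) := by
  have hε : 0 < T⁻¹ := inv_pos.2 hT
  set μ := spectralMeasure V (delta V 0)
  set S := {E : ℝ | lengthScale (polyA V) (polyB V) T⁻¹ E ≤ ENNReal.ofReal L}
  let W (E : ℝ) : ℝ := 5 * T⁻¹ * ballWeight (L + 1) (greenFunction V ⟨E, T⁻¹⟩)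
  have hW_nonneg (E : ℝ) : 0 ≤ W E :=
    mul_nonneg (by positivity) (Finset.sum_nonneg fun n _ => sq_nonneg _)
  have h_le : μ S ≤ ENNReal.ofReal (∫ E, W E) :=
    calc μ S ≤ ∫⁻ E in Metric.thickening T⁻¹ S,
            ENNReal.ofReal (∫ x, ((x : ℂ) - ⟨E, T⁻¹⟩)⁻¹ ∂μ).im :=
          measure_le_setLIntegral_thickening_poisson μ hε S
      _ ≤ ∫⁻ E in Metric.thickening T⁻¹ S, ENNReal.ofReal (W E) := by
          refine setLIntegral_mono' Metric.isOpen_thickening.measurableSet fun E' hE' => ?_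
          obtain ⟨E, hE, hEE'⟩ := Metric.mem_thickening_iff.1 hE'
          exact ENNReal.ofReal_le_ofReal
            (im_integral_inv_sub_le_ballWeight_greenFunction V hd hε hL hE hEE')
      _ ≤ ∫⁻ E, ENNReal.ofReal (W E) := setLIntegral_le_lintegral _ _
      _ = ENNReal.ofReal (∫ E, W E) := (ofReal_integral_eq_lintegral_ofReal
          ((integrable_ballWeight_greenFunction V hε _).const_mul _)
          (Eventually.of_forall hW_nonneg)).symm
  calc μ.real S ≤ ∫ E, W E := ENNReal.toReal_le_of_le_ofReal (integral_nonneg hW_nonneg) h_le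
    _ = 5 * Real.pi * timeAverage T (fun t => ballWeight (L + 1) (wavepacket V t)) := by
        rw [timeAverage_ballWeight_eq_integral_greenFunction V hT, integral_const_mul]
        field_simp

end DynamicalBound

end DiscreteSchrodinger

end

theorem theorem7 :
    ∃ C : ℝ, 0 < C ∧ ∀ (d : ℕ) (_ : 0 < d) (V : (Fin d → ℤ) → ℝ) (T L : ℝ), 0 < T → 1 < L →
      C * (Lattice.spectralMeasure V (Lattice.delta V 0)).real
          {E : ℝ | Lattice.lengthScale (Lattice.polyA V) (Lattice.polyB V) T⁻¹ E
            ≤ ENNReal.ofReal L}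
        < Lattice.timeAverage T (fun t => Lattice.ballWeight (L + 1) (Lattice.wavepacket V t)) := by
  refine ⟨1 / 32, by norm_num, fun d hd V T L hT hL => ?_⟩
  have h_measure :=
    DiscreteSchrodinger.measureReal_lengthScale_le_timeAverage V hd hT (zero_le_one.trans hL.le)
  have h_pos := DiscreteSchrodinger.timeAverage_ballWeight_pos V hT (by linarith : 1 < L + 1)
  nlinarith [Real.pi_lt_four]
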